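/- Setting. Let $N,d\ge 1$, $\mu_*\in\mathbb{R}^d$, $\sigma\in\mathbb{R}$, let $\Sigma_x,\Sigma_y,\Sigma\in\mathbb{R}^{d\times d}$ be symmetric positive definite and let $A\in\mathbb{R}^{d\times d}$ be non-singular. At each time $t=1,2,\dots$ there are, for the arms $i=1,\dots,N$, mutually independent contexts $x_i(t)\sim N(0,\Sigma_x)$, output noises $\varepsilon_{y_i}(t)\sim N(0,\Sigma_y)$ and reward noises $\varepsilon_{r_i}(t)\sim N(0,\sigma^2)$. The outputs are $y_i(t)=Ax_i(t)+\varepsilon_{y_i}(t)$, the reward of arm $i$ is $r_i(t)=x_i(t)^\top\mu_*+\varepsilon_{r_i}(t)$, and $\widehat x_i(t)=Dy_i(t)$ with $D=(A^\top\Sigma_y^{-1}A+\Sigma_x^{-1})^{-1}A^\top\Sigma_y^{-1}$. Algorithm (Thompson sampling). Put $B(1)=\Sigma^{-1}$ and $\widehat\mu(1)=0$. At time $t$, draw $\widetilde\mu(t)$ with conditional law $N(\widehat\mu(t),B(t)^{-1})$ given everything that happened before time $t$; the contexts and noises of time $t$ are independent of the past and of $\widetilde\mu(t)$. Select an arm $a(t)\in\arg\max_{1\le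 i\le N}\widehat x_i(t)^\top\widetilde\mu(t)$, observe $r_{a(t)}(t)$, and update $$B(t+1)=B(t)+\widehat x_{a(t)}(t)\widehat x_{a(t)}(t)^\top,\qquad \widehat\mu(t+1)=B(t+1)^{-1}\bigl(B(t)\widehat\mu(t)+\widehat x_{a(t)}(t)\,r_{a(t)}(t)\bigr).$$ Theorem. (i) $\lim_{t\to\infty}\widehat\mu(t)=\mu_*$ almost surely. (ii) $\widehat\mu(t)$ is square integrable for every $t$, and $\|\mathrm{Cov}(\widehat\mu(t))\|=O(t^{-1})$ as $t\to\infty$, where $\|\cdot\|$ is the operator norm. (iii) If $\mu_*\ne 0$, then $t^{-1}B(t)$ converges almost surely to a deterministic positive definite matrix. -/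

import Mathlib

open MeasureTheory ProbabilityTheory Filter Topology

noncomputable section

namespace POCMAB

/-- `d`-dimensional Euclidean space. -/
abbrev Vec (d : ℕ) : Type := EuclideanSpace ℝ (Fin d)

/-- The parameters of a contextual bandit with partially observed `d`-dimensional contexts. -/
structure Params (d : ℕ) where
  /-- the known transformation matrix from contexts to outputs -/
  A : Matrix (Fin d) (Fin d) ℝ
  /-- covariance matrix of the contexts -/
  covX : Matrix (Fin d) (Fin d) ℝ
  /-- covariance matrix of the output observation noise -/
  covY : Matrix (Fin d) (Fin d) ℝ
  /-- standard deviation of the reward observation noise -/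
  σ : ℝ
  /-- the unknown true parameter -/
  μstar : Vec d
  isUnit_det_A : IsUnit A.det
  posDef_covX : covX.PosDef
  posDef_covY : covY.PosDef

/-- The matrix `D = (Aᵀ Σy⁻¹ A + Σx⁻¹)⁻¹ Aᵀ Σy⁻¹`, which maps an output to the conditional
expectation of the context given that output. -/
def Params.D {d : ℕ} (M : Params d) : Matrix (Fin d) (Fin d) ℝ :=
  (M.A.transpose * M.covY⁻¹ * M.A + M.covX⁻¹)⁻¹ * M.A.transpose * M.covY⁻¹

/-- The joint law of the randomness of the environment in one round: for the `N` arms, independent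
triples of a context `∼ N(0, Σx)`, an output noise `∼ N(0, Σy)` and a reward noise `∼ N(0, σ²)`,
the three being independent as well. -/
def Params.envLaw {d : ℕ} (M : Params d) (N : ℕ) : Measure (Fin N → Vec d × Vec d × ℝ) :=
  Measure.pi fun _ : Fin N =>
    (multivariateGaussian 0 M.covX).prod
      ((multivariateGaussian 0 M.covY).prod (gaussianReal 0 (M.σ ^ 2).toNNReal))

/-- The random quantities of an interaction of an agent with an `N`-armed bandit. Rounds are
numbered from `0`: round `n : ℕ` is the time `t = n + 1` in the numbering `t = 1, 2, …`. -/
structure Run (Ω : Type*) (d N : ℕ) where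
  /-- `x n i` is the (unobserved) context of arm `i` in round `n` -/
  x : ℕ → Fin N → Ω → Vec d
  /-- `noiseY n i` is the output observation noise of arm `i` in round `n` -/
  noiseY : ℕ → Fin N → Ω → Vec d
  /-- `noiseR n i` is the reward observation noise of arm `i` in round `n` -/
  noiseR : ℕ → Fin N → Ω → ℝ
  /-- `draw n` is the parameter sampled from the posterior in round `n` -/
  draw : ℕ → Ω → Vec d
  /-- `arm n` is the arm selected in round `n` -/
  arm : ℕ → Ω → Fin N

namespace Run

variable {Ω : Type*} {d N : ℕ}

/-- The randomness of the environment in round `n`. -/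
def env (R : Run Ω d N) (n : ℕ) (ω : Ω) : Fin N → Vec d × Vec d × ℝ :=
  fun i => (R.x n i ω, R.noiseY n i ω, R.noiseR n i ω)

/-- The σ-algebra of everything that happened strictly before round `n`. -/
@[reducible]
def history (R : Run Ω d N) (n : ℕ) : MeasurableSpace Ω :=
  ⨆ k : Fin n, MeasurableSpace.comap
    (fun ω => (R.env k ω, R.draw k ω, R.arm k ω)) inferInstance

/-- The output `y = A x + noise` of arm `i` in round `n`. -/
def output (R : Run Ω d N) (M : Params d) (n : ℕ) (i : Fin N) (ω : Ω) : Vec d :=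
  WithLp.toLp 2 (M.A.mulVec (R.x n i ω).ofLp) + R.noiseY n i ω

/-- The context estimate `D y` of arm `i` in round `n`. -/
def xhat (R : Run Ω d N) (M : Params d) (n : ℕ) (i : Fin N) (ω : Ω) : Vec d :=
  WithLp.toLp 2 (M.D.mulVec (R.output M n i ω).ofLp)

/-- The reward `xᵀ μ_* + noise` of arm `i` in round `n`. -/
def reward (R : Run Ω d N) (M : Params d) (n : ℕ) (i : Fin N) (ω : Ω) : ℝ :=
  inner ℝ (R.x n i ω) M.μstar + R.noiseR n i ω

/-- The context estimate of the selected arm. -/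
def xhatSel (R : Run Ω d N) (M : Params d) (n : ℕ) (ω : Ω) : Vec d :=
  R.xhat M n (R.arm n ω) ω

/-- The reward of the selected arm. -/
def rewardSel (R : Run Ω d N) (M : Params d) (n : ℕ) (ω : Ω) : ℝ :=
  R.reward M n (R.arm n ω) ω

/-- The posterior precision matrix at the beginning of round `n`, that is, `B(n + 1)` in the
numbering `t = 1, 2, …`; the prior precision is `Sig⁻¹`. -/
def B (R : Run Ω d N) (M : Params d) (Sig : Matrix (Fin d) (Fin d) ℝ) :
    ℕ → Ω → Matrix (Fin d) (Fin d) ℝ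
  | 0, _ => Sig⁻¹
  | n + 1, ω => R.B M Sig n ω + Matrix.vecMulVec (R.xhatSel M n ω).ofLp (R.xhatSel M n ω).ofLp

/-- The posterior mean at the beginning of round `n`, that is, `μ̂(n + 1)` in the numbering
`t = 1, 2, …`. -/
def muHat (R : Run Ω d N) (M : Params d) (Sig : Matrix (Fin d) (Fin d) ℝ) : ℕ → Ω → Vec d
  | 0, _ => 0
  | n + 1, ω => WithLp.toLp 2 ((R.B M Sig (n + 1) ω)⁻¹.mulVec
      ((R.B M Sig n ω).mulVec (R.muHat M Sig n ω).ofLp +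
        R.rewardSel M n ω • (R.xhatSel M n ω).ofLp))

/-- `R` is a run of Thompson sampling with prior matrix `Sig` in the bandit with parameters `M`,
under the probability measure `P`. -/
structure IsThompsonSampling [MeasurableSpace Ω] (R : Run Ω d N) (M : Params d)
    (Sig : Matrix (Fin d) (Fin d) ℝ) (P : Measure Ω) : Prop where
  measurable_x : ∀ n i, Measurable (R.x n i)
  measurable_noiseY : ∀ n i, Measurable (R.noiseY n i)
  measurable_noiseR : ∀ n i, Measurable (R.noiseR n i)
  measurable_draw : ∀ n, Measurable (R.draw n)
  measurable_arm : ∀ n, Measurable (R.arm n)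
  /-- the law of contexts and noises in each round -/
  map_env : ∀ n, P.map (R.env n) = M.envLaw N
  /-- contexts and noises of a round are independent of the past and of the posterior sample -/
  indep_env : ∀ n, Indep (MeasurableSpace.comap (R.env n) inferInstance)
    (R.history n ⊔ MeasurableSpace.comap (R.draw n) inferInstance) P
  /-- given the past, the sample is drawn from `N(μ̂, B⁻¹)` -/
  draw_law : ∀ n (s : Set (Vec d)), MeasurableSet s →
    P⟦R.draw n ⁻¹' s | R.history n⟧ =ᵐ[P] fun ω =>
      (multivariateGaussian (R.muHat M Sig n ω) (R.B M Sig n ω)⁻¹).real s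
  /-- the selected arm maximizes the estimated reward under the sampled parameter -/
  arm_max : ∀ n, ∀ᵐ ω ∂P, ∀ i : Fin N,
    inner ℝ (R.xhat M n i ω) (R.draw n ω) ≤ inner ℝ (R.xhatSel M n ω) (R.draw n ω)

end Run

/-- The covariance matrix of a random vector. -/
def covMat {Ω : Type*} [MeasurableSpace Ω] {d : ℕ} (X : Ω → Vec d) (P : Measure Ω) :
    Matrix (Fin d) (Fin d) ℝ :=
  Matrix.of fun i j => covariance (fun ω => X ω i) (fun ω => X ω j) P

/-- The operator norm of a matrix with respect to the Euclidean norm. -/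
def opNorm {d : ℕ} (C : Matrix (Fin d) (Fin d) ℝ) : ℝ :=
  ‖Matrix.toEuclideanCLM (n := Fin d) (𝕜 := ℝ) C‖

end POCMAB

end

/-! The matrix `D` makes the estimate the best linear predictor of the context, so the prediction
error `resid` of the reward `⟨est, μstar⟩ + resid` is uncorrelated with `est`. Everything being
Gaussian, the pairs `(est, resid)` and `(est, -resid)` have the same law. The arm is chosen by
looking only at the estimates and at the posterior sample, hence selection does not bias the error:
the products `resid • est` along the selected arms are martingale differences. Their sum is the
`score`, and the updates telescope to `B n (muHat n - μstar) = score n - Sig⁻¹ μstar`.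

Two facts then control the error. The score is `o(n)` almost surely and has second moment `O(n)`, by
the strong law and orthogonality for martingale differences. The precision grows linearly in all
directions: near a fixed direction `u`, with positive probability the estimates of all arms have
components along `u` bounded away from zero, so that any selection rule gains information. Such
events are independent over rounds, and a Chernoff bound, compactness of the sphere and
Borel–Cantelli give `B n ≥ c n` outside an event of exponentially small probability, and eventually
almost surely. Consistency follows by division.

For the covariance, the mean squared error is split along that event. Outside it the error is at
most `‖score - Sig⁻¹ μstar‖ / (c n)`; on it the prior precision still gives a bound without the
factor `n`, and a polynomial bound on fourth moments is absorbed by the exponentially small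
probability.

For the limit of `B n / n`, consistency and the growth of `B` make the posterior samples lie near
`μstar` with asymptotic frequency one. By the strong law, averages of `est estᵀ` at the selected
arms are asymptotic to averages of their means given the sample. Such a mean is a continuous
function of the sample away from `0`, since ties are null there; this is where `μstar ≠ 0` enters.
The linear growth of `B` makes the limit positive definite. -/

noncomputable section

namespace POCMAB

/-! ### Conditional expectations and the strong law for martingale differences -/

section

/-- If `X` is independent of `m` and `W` is `m`-measurable, then conditioning `h (X, W)` on `m`
amounts to integrating out `X`. -/
theorem condExp_comp_of_indep {Ω E F : Type*} {m : MeasurableSpace Ω} [mΩ : MeasurableSpace Ω]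
    [mE : MeasurableSpace E] [mF : MeasurableSpace F] {P : Measure Ω} [IsProbabilityMeasure P]
    (hm : m ≤ mΩ) {X : Ω → E} (hX : Measurable X) {W : Ω → F} (hW : Measurable[m] W)
    (hind : Indep (MeasurableSpace.comap X inferInstance) m P) {h : E × F → ℝ} (hh : Measurable h)
    (hint : Integrable (fun ω => h (X ω, W ω)) P) :
    P[fun ω => h (X ω, W ω) | m] =ᵐ[P] fun ω => ∫ e, h (e, W ω) ∂(P.map X) := by
  have hWm : Measurable W := hW.mono hm le_rfl
  have : IsProbabilityMeasure (P.map X) := Measure.isProbabilityMeasure_map hX.aemeasurable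
  have hHm : StronglyMeasurable (fun w => ∫ e, h (e, w) ∂(P.map X)) :=
    hh.stronglyMeasurable.integral_prod_left'
  have hprod : ∀ {G : Type _} [MeasurableSpace G] (V : Ω → G), Measurable[m] V →
      P.map (fun ω => (X ω, V ω)) = (P.map X).prod (P.map V) := by
    intro G _ V hV
    refine (indepFun_iff_map_prod_eq_prod_map_map hX.aemeasurable
      (hV.mono hm le_rfl).aemeasurable).1 ?_
    exact indep_of_indep_of_le_right hind hV.comap_le
  symm
  have hHint : Integrable (fun ω => ∫ e, h (e, W ω) ∂(P.map X)) P := by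
    have h1 : Integrable h ((P.map X).prod (P.map W)) := by
      rw [← hprod W hW]
      exact (integrable_map_measure hh.aestronglyMeasurable (hX.prodMk hWm).aemeasurable).2 hint
    have h2 := h1.integral_prod_right
    exact (integrable_map_measure hHm.aestronglyMeasurable hWm.aemeasurable).1 h2
  refine ae_eq_condExp_of_forall_setIntegral_eq hm hint (fun _ _ _ => hHint.integrableOn) ?_
    ((hHm.comp_measurable hW).aestronglyMeasurable)
  intro s hs _
  -- Adjoining the indicator of `s` to `W` keeps an `m`-measurable variable, so the integral over
  -- `s` becomes a full integral against a product law and Fubini applies.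
  let V : Ω → F × ℝ := fun ω => (W ω, s.indicator 1 ω)
  have hV : Measurable[m] V :=
    Measurable.prodMk hW ((measurable_const (a := (1 : ℝ))).indicator hs)
  have hVm := hV.mono hm le_rfl
  let g : E × (F × ℝ) → ℝ := fun p => p.2.2 * h (p.1, p.2.1)
  have hg : Measurable g := by fun_prop
  have e1 : ∀ (φ : Ω → ℝ), ∫ ω in s, φ ω ∂P = ∫ ω, (V ω).2 * φ ω ∂P := by
    intro φ
    rw [← integral_indicator (hm s hs)]
    refine integral_congr_ae (Eventually.of_forall fun ω => ?_)
    by_cases hω : ω ∈ s <;> simp [V, hω]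
  have gint : Integrable g ((P.map X).prod (P.map V)) := by
    rw [← hprod V hV, integrable_map_measure hg.aestronglyMeasurable (hX.prodMk hVm).aemeasurable]
    refine Integrable.mono' hint.norm (hg.comp (hX.prodMk hVm)).aestronglyMeasurable
      (Eventually.of_forall fun ω => ?_)
    by_cases hω : ω ∈ s <;> simp [g, V, hω]
  have e2 : ∫ ω, (V ω).2 * h (X ω, W ω) ∂P = ∫ p, g p ∂((P.map X).prod (P.map V)) := by
    rw [← hprod V hV, integral_map (hX.prodMk hVm).aemeasurable hg.aestronglyMeasurable]
  rw [e1, e1, e2, integral_prod_symm _ gint,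
    integral_map hVm.aemeasurable hg.stronglyMeasurable.integral_prod_left'.aestronglyMeasurable]
  simp only [g, integral_const_mul]
  rfl

variable {Ω : Type*} {mΩ : MeasurableSpace Ω} {P : Measure Ω} [IsProbabilityMeasure P]

theorem stronglyMeasurable_sum_range_of_adapted {ℱ : Filtration ℕ mΩ} {ξ : ℕ → Ω → ℝ}
    (hadp : ∀ n, StronglyMeasurable[ℱ (n + 1)] (ξ n)) (n : ℕ) :
    StronglyMeasurable[ℱ n] (fun ω => ∑ i ∈ Finset.range n, ξ i ω) :=
  Finset.stronglyMeasurable_fun_sum _ fun i hi =>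
    (hadp i).mono (ℱ.mono (Finset.mem_range.1 hi))

/-- Martingale differences are orthogonal in `L²`. -/
theorem integral_sq_sum_martingaleDifference {ℱ : Filtration ℕ mΩ} {ξ : ℕ → Ω → ℝ}
    (hadp : ∀ n, StronglyMeasurable[ℱ (n + 1)] (ξ n)) (hL : ∀ n, MemLp (ξ n) 2 P)
    (h0 : ∀ n, P[ξ n | ℱ n] =ᵐ[P] 0) (n : ℕ) :
    ∫ ω, (∑ i ∈ Finset.range n, ξ i ω) ^ 2 ∂P = ∑ i ∈ Finset.range n, ∫ ω, (ξ i ω) ^ 2 ∂P := by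
  have hS : ∀ n, MemLp (fun ω => ∑ i ∈ Finset.range n, ξ i ω) 2 P := fun n =>
    memLp_finsetSum _ fun i _ => hL i
  induction n with
  | zero => simp
  | succ n ih =>
    have hcross : ∫ ω, (∑ i ∈ Finset.range n, ξ i ω) * ξ n ω ∂P = 0 := by
      have hint : Integrable ((fun ω => ∑ i ∈ Finset.range n, ξ i ω) * ξ n) P :=
        (hS n).integrable_mul (hL n)
      have h1 := condExp_mul_of_stronglyMeasurable_left
        (stronglyMeasurable_sum_range_of_adapted hadp n) hint ((hL n).integrable one_le_two)
      have h2 := integral_condExp (ℱ.le n) (μ := P)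
        (f := (fun ω => ∑ i ∈ Finset.range n, ξ i ω) * ξ n)
      change ∫ ω, ((fun ω => ∑ i ∈ Finset.range n, ξ i ω) * ξ n) ω ∂P = 0
      rw [← h2]
      refine integral_eq_zero_of_ae ?_
      filter_upwards [h1, h0 n] with ω h h'
      rw [h, Pi.mul_apply, h']
      simp
    have e : (fun ω => (∑ i ∈ Finset.range (n + 1), ξ i ω) ^ 2) = fun ω =>
        (∑ i ∈ Finset.range n, ξ i ω) ^ 2 + (2 * ((∑ i ∈ Finset.range n, ξ i ω) * ξ n ω)
          + (ξ n ω) ^ 2) := by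
      funext ω
      rw [Finset.sum_range_succ]; ring
    have i1 := (hS n).integrable_sq
    have i2 : Integrable (fun ω => 2 * ((∑ i ∈ Finset.range n, ξ i ω) * ξ n ω)) P :=
      ((hS n).integrable_mul (hL n)).const_mul 2
    have i3 := (hL n).integrable_sq
    rw [e, integral_add i1 (g := fun ω => 2 * ((∑ i ∈ Finset.range n, ξ i ω) * ξ n ω) + (ξ n ω) ^ 2)
      (i2.add i3), integral_add i2 i3, integral_const_mul, hcross, ih,
      Finset.sum_range_succ]
    ring

/-- Kronecker's lemma with weights `n + 1`. -/
theorem tendsto_average_of_tendsto_weighted_sum {a : ℕ → ℝ} {l : ℝ}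
    (h : Tendsto (fun n => ∑ i ∈ Finset.range n, ((i : ℝ) + 1)⁻¹ * a i) atTop (𝓝 l)) :
    Tendsto (fun n : ℕ => (n : ℝ)⁻¹ * ∑ i ∈ Finset.range n, a i) atTop (𝓝 0) := by
  set Y := fun n => ∑ i ∈ Finset.range n, ((i : ℝ) + 1)⁻¹ * a i with hY
  -- Summation by parts: the average of `a` is `Y n` minus the Cesàro mean of `Y`, and both have the
  -- same limit.
  have key : ∀ n : ℕ, ∑ i ∈ Finset.range n, a i = n * Y n - ∑ i ∈ Finset.range n, Y i := by
    intro n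
    induction n with
    | zero => simp
    | succ n ih =>
      have : Y (n + 1) = Y n + ((n : ℝ) + 1)⁻¹ * a n := Finset.sum_range_succ _ _
      rw [Finset.sum_range_succ, ih, Finset.sum_range_succ, this]
      have : (n : ℝ) + 1 ≠ 0 := by positivity
      push_cast
      field_simp
      ring
  have h1 := h.sub h.cesaro
  rw [sub_self] at h1
  refine h1.congr' ?_
  filter_upwards [eventually_gt_atTop 0] with n hn
  have : (n : ℝ) ≠ 0 := by positivity
  rw [key, mul_sub, inv_mul_cancel_left₀ this]

/-- Strong law of large numbers for martingale differences bounded in `L²`. -/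
theorem ae_tendsto_average_martingaleDifference {ℱ : Filtration ℕ mΩ} {ξ : ℕ → Ω → ℝ}
    (hadp : ∀ n, StronglyMeasurable[ℱ (n + 1)] (ξ n)) (hL : ∀ n, MemLp (ξ n) 2 P)
    {K : ℝ} (hK : ∀ n, ∫ ω, (ξ n ω) ^ 2 ∂P ≤ K) (h0 : ∀ n, P[ξ n | ℱ n] =ᵐ[P] 0) :
    ∀ᵐ ω ∂P, Tendsto (fun n : ℕ => (n : ℝ)⁻¹ * ∑ i ∈ Finset.range n, ξ i ω) atTop (𝓝 0) := by
  -- The weights `1 / (i + 1)` are square summable, so the weighted sums form an `L²`-bounded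
  -- martingale. It converges almost surely, and Kronecker's lemma concludes.
  let ζ : ℕ → Ω → ℝ := fun i ω => ((i : ℝ) + 1)⁻¹ * ξ i ω
  have zadp : ∀ n, StronglyMeasurable[ℱ (n + 1)] (ζ n) := fun n => (hadp n).const_mul _
  have zL : ∀ n, MemLp (ζ n) 2 P := fun n => (hL n).const_mul _
  have z0 : ∀ n, P[ζ n | ℱ n] =ᵐ[P] 0 := by
    intro n
    filter_upwards [condExp_smul (((n : ℝ) + 1)⁻¹) (ξ n) (ℱ n) (μ := P), h0 n] with ω h h'
    change P[((n : ℝ) + 1)⁻¹ • ξ n | ℱ n] ω = 0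
    rw [h, Pi.smul_apply, h']
    simp
  let Y : ℕ → Ω → ℝ := fun n ω => ∑ i ∈ Finset.range n, ζ i ω
  have YL : ∀ n, MemLp (Y n) 2 P := fun n => memLp_finsetSum _ fun i _ => zL i
  have hY : Martingale Y ℱ P := by
    refine martingale_of_condExp_sub_eq_zero_nat
      (fun n => stronglyMeasurable_sum_range_of_adapted zadp n)
      (fun n => (YL n).integrable one_le_two) fun n => ?_
    have : Y (n + 1) - Y n = ζ n := by
      funext ω
      simp [Y, Finset.sum_range_succ]
    rw [this]
    exact z0 n
  have hsum : Summable (fun i : ℕ => (((i : ℝ) + 1) ^ 2)⁻¹) := by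
    have := (summable_nat_add_iff 1).2 (Real.summable_nat_pow_inv.2 (one_lt_two : 1 < 2))
    simpa using this
  set C := |K| * ∑' i : ℕ, (((i : ℝ) + 1) ^ 2)⁻¹
  have hbd2 : ∀ n, ∫ ω, (Y n ω) ^ 2 ∂P ≤ C := by
    intro n
    rw [integral_sq_sum_martingaleDifference zadp zL z0]
    calc ∑ i ∈ Finset.range n, ∫ ω, (ζ i ω) ^ 2 ∂P
        ≤ ∑ i ∈ Finset.range n, |K| * (((i : ℝ) + 1) ^ 2)⁻¹ := by
          refine Finset.sum_le_sum fun i _ => ?_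
          simp only [ζ, mul_pow, integral_const_mul, inv_pow]
          rw [mul_comm]
          exact mul_le_mul_of_nonneg_right ((hK i).trans (le_abs_self K)) (by positivity)
      _ ≤ C := by
          rw [← Finset.mul_sum]
          exact mul_le_mul_of_nonneg_left (hsum.sum_le_tsum _ fun i _ => by positivity)
            (abs_nonneg K)
  have hbd : ∀ n, eLpNorm (Y n) 1 P ≤ (Real.toNNReal (1 + C) : ENNReal) := by
    intro n
    rw [eLpNorm_one_eq_lintegral_enorm, ← ofReal_integral_norm_eq_lintegral_enorm
      ((YL n).integrable one_le_two)]
    refine ENNReal.ofReal_le_ofReal ?_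
    calc ∫ ω, ‖Y n ω‖ ∂P ≤ ∫ ω, (1 + (Y n ω) ^ 2) ∂P := by
          refine integral_mono ((YL n).integrable one_le_two).norm
            ((integrable_const _).add (YL n).integrable_sq) fun ω => ?_
          simp only [Real.norm_eq_abs]
          nlinarith [sq_nonneg (|Y n ω| - 1), sq_abs (Y n ω)]
      _ ≤ 1 + C := by
          rw [integral_add (integrable_const _) (YL n).integrable_sq]
          simpa using hbd2 n
  filter_upwards [Submartingale.exists_ae_tendsto_of_bdd hY.submartingale hbd] with ω hω
  obtain ⟨l, hl⟩ := hω
  exact tendsto_average_of_tendsto_weighted_sum hl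

end

/-! ### Gaussian law of one arm: estimate and prediction error -/

section

variable {d N : ℕ}

/-- The law of the context, the output noise and the reward noise of a single arm. -/
def Params.armLaw (M : Params d) : Measure (Vec d × Vec d × ℝ) :=
  (multivariateGaussian 0 M.covX).prod
    ((multivariateGaussian 0 M.covY).prod (gaussianReal 0 (M.σ ^ 2).toNNReal))

instance (M : Params d) : IsGaussian M.armLaw := by unfold Params.armLaw; infer_instance

instance (M : Params d) : IsProbabilityMeasure M.armLaw := by
  unfold Params.armLaw; infer_instance

theorem Params.envLaw_eq (M : Params d) (N : ℕ) : M.envLaw N = Measure.pi fun _ => M.armLaw := rfl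

instance (M : Params d) : IsProbabilityMeasure (M.envLaw N) := by
  rw [M.envLaw_eq]; infer_instance

/-- The context estimate as a linear function of the data of an arm. -/
def Params.est (M : Params d) : (Vec d × Vec d × ℝ) →L[ℝ] Vec d :=
  (Matrix.toEuclideanCLM (n := Fin d) (𝕜 := ℝ) M.D).comp
    ((Matrix.toEuclideanCLM (n := Fin d) (𝕜 := ℝ) M.A).comp (ContinuousLinearMap.fst ℝ _ _) +
      (ContinuousLinearMap.fst ℝ _ _).comp (ContinuousLinearMap.snd ℝ _ _))

/-- The error of the reward prediction from the context estimate, as a linear function of the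
data of an arm. -/
def Params.resid (M : Params d) : (Vec d × Vec d × ℝ) →L[ℝ] ℝ :=
  (innerSL ℝ M.μstar).comp (ContinuousLinearMap.fst ℝ _ _) +
      (ContinuousLinearMap.snd ℝ _ _).comp (ContinuousLinearMap.snd ℝ _ _) -
    (innerSL ℝ M.μstar).comp M.est

theorem charFunDual_multivariateGaussian_innerSL {S : Matrix (Fin d) (Fin d) ℝ}
    (hS : S.PosSemidef) (v : Vec d) :
    charFunDual (multivariateGaussian 0 S) (innerSL ℝ v) =
      Complex.exp (-((v.ofLp ⬝ᵥ S.mulVec v.ofLp : ℝ) : ℂ) / 2) := by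
  have := charFun_multivariateGaussian (μ := 0) hS v
  rw [charFun_eq_charFunDual_toDualMap] at this
  have e : innerSL ℝ v = InnerProductSpace.toDualMap ℝ _ v := by ext; simp
  rw [e, this]
  simp [neg_div]

theorem charFunDual_gaussianReal_innerSL (v : NNReal) (c : ℝ) :
    charFunDual (gaussianReal 0 v) (innerSL ℝ c) = Complex.exp (-((v * c ^ 2 : ℝ) : ℂ) / 2) := by
  have := charFun_gaussianReal (μ := 0) (v := v) c
  rw [charFun_eq_charFunDual_toDualMap] at this
  have e : innerSL ℝ c = InnerProductSpace.toDualMap ℝ _ c := by ext; simp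
  rw [e, this]
  simp [neg_div]

theorem Params.isUnit_det_posterior_precision (M : Params d) :
    IsUnit (M.A.transpose * M.covY⁻¹ * M.A + M.covX⁻¹).det := by
  refine (Matrix.PosDef.posSemidef_add ?_ M.posDef_covX.inv).det_pos.ne'.isUnit
  have := M.posDef_covY.inv.posSemidef.conjTranspose_mul_mul_same M.A
  simpa using this

/-- The normal equations of linear prediction: `D` is also `Σx Aᵀ (A Σx Aᵀ + Σy)⁻¹`. -/
theorem Params.D_mul (M : Params d) :
    M.D * (M.A * M.covX * M.A.transpose + M.covY) = M.covX * M.A.transpose := by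
  have hx : IsUnit M.covX.det := M.posDef_covX.det_pos.ne'.isUnit
  have hy : IsUnit M.covY.det := M.posDef_covY.det_pos.ne'.isUnit
  have hGu := M.isUnit_det_posterior_precision
  have key : M.A.transpose * M.covY⁻¹ * (M.A * M.covX * M.A.transpose + M.covY) =
      (M.A.transpose * M.covY⁻¹ * M.A + M.covX⁻¹) * (M.covX * M.A.transpose) := by
    rw [mul_add, add_mul, Matrix.nonsing_inv_mul_cancel_right _ _ hy,
      Matrix.nonsing_inv_mul_cancel_left _ _ hx]
    simp only [Matrix.mul_assoc]
  rw [Params.D, Matrix.mul_assoc, Matrix.mul_assoc, ← Matrix.mul_assoc M.A.transpose, key,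
    Matrix.nonsing_inv_mul_cancel_left _ _ hGu]

/-- The left side is the covariance of estimate and context, the right side that of the estimate
with itself; equality is the orthogonality of `x - est` and `est`. -/
theorem Params.D_mul_covX (M : Params d) :
    M.D * M.A * M.covX = M.D * (M.A * M.covX * M.A.transpose + M.covY) * M.D.transpose := by
  have h1 : M.covX.transpose = M.covX := by simpa using M.posDef_covX.isHermitian.eq
  have h2 : M.covY.transpose = M.covY := by simpa using M.posDef_covY.isHermitian.eq
  have h := congrArg (fun X => (X * M.D.transpose).transpose) M.D_mul
  simp only [Matrix.transpose_mul, Matrix.transpose_add, Matrix.transpose_transpose, h1, h2] at h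
  simp only [Matrix.mul_assoc] at h ⊢
  exact h.symm

/-- The place where nonsingularity of `A` enters; it keeps the law of the estimate nondegenerate. -/
theorem Params.isUnit_det_D (M : Params d) : IsUnit M.D.det := by
  have hy : IsUnit M.covY.det := M.posDef_covY.det_pos.ne'.isUnit
  have hGu := M.isUnit_det_posterior_precision
  rw [Params.D, Matrix.det_mul, Matrix.det_mul, Matrix.det_transpose]
  exact ((Matrix.isUnit_nonsing_inv_det _ hGu).mul M.isUnit_det_A).mul
    (Matrix.isUnit_nonsing_inv_det _ hy)

theorem Params.est_ofLp (M : Params d) (z : Vec d × Vec d × ℝ) :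
    (M.est z).ofLp = M.D.mulVec (M.A.mulVec z.1.ofLp + z.2.1.ofLp) := by
  simp [Params.est, Matrix.mulVec_add]

theorem vec_inner_eq (x y : Vec d) : inner ℝ x y = x.ofLp ⬝ᵥ y.ofLp := by
  simp [PiLp.inner_apply, dotProduct, mul_comm]

/-- The point is the absence of a cross term between `p` and `c`, that is, uncorrelatedness of
estimate and error. Later only the evenness in `c` is used. -/
theorem Params.charFunDual_armLaw (M : Params d) (p : Vec d) (c : ℝ) :
    charFunDual M.armLaw ((innerSL ℝ p).comp M.est + c • M.resid) =
    Complex.exp (-(((p.ofLp ⬝ᵥ (M.D * (M.A * M.covX * M.A.transpose + M.covY) *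
      M.D.transpose).mulVec p.ofLp) + c ^ 2 * (
        (M.μstar.ofLp ⬝ᵥ M.covX.mulVec M.μstar.ofLp) - M.μstar.ofLp ⬝ᵥ
        (M.D * (M.A * M.covX * M.A.transpose + M.covY) * M.D.transpose).mulVec M.μstar.ofLp
        + (M.σ ^ 2).toNNReal) : ℝ) : ℂ) / 2) := by
  -- Total coefficient of the estimate, which occurs both directly and inside `resid`.
  set w : Fin d → ℝ := p.ofLp - c • M.μstar.ofLp with hw
  have hp : p.ofLp = w + c • M.μstar.ofLp := by simp [hw]
  have hrepr : ∀ z : Vec d × Vec d × ℝ, ((innerSL ℝ p).comp M.est + c • M.resid) z =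
      w ⬝ᵥ (M.D * M.A).mulVec z.1.ofLp + w ⬝ᵥ M.D.mulVec z.2.1.ofLp
        + c * M.μstar.ofLp ⬝ᵥ z.1.ofLp + c * z.2.2 := by
    intro z
    have h : ((innerSL ℝ p).comp M.est + c • M.resid) z = inner ℝ p (M.est z) +
      c * (inner ℝ M.μstar z.1 + z.2.2 - inner ℝ M.μstar (M.est z)) := rfl
    rw [h]
    simp only [vec_inner_eq, Params.est_ofLp, hp, Matrix.mulVec_add, Matrix.mulVec_mulVec,
      add_dotProduct, dotProduct_add, smul_dotProduct, smul_eq_mul]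
    ring
  have e1 : ((innerSL ℝ p).comp M.est + c • M.resid).comp (ContinuousLinearMap.inl ℝ _ _) =
      innerSL ℝ (WithLp.toLp 2 ((M.D * M.A).transpose.mulVec w + c • M.μstar.ofLp) : Vec d) := by
    ext x
    rw [ContinuousLinearMap.comp_apply, hrepr]
    simp [vec_inner_eq, Matrix.dotProduct_mulVec, Matrix.mulVec_transpose,
      -Matrix.transpose_mul]
  have e2 : (((innerSL ℝ p).comp M.est + c • M.resid).comp (ContinuousLinearMap.inr ℝ _ _)).comp
      (ContinuousLinearMap.inl ℝ _ _) =
      innerSL ℝ (WithLp.toLp 2 (M.D.transpose.mulVec w) : Vec d) := by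
    ext x
    rw [ContinuousLinearMap.comp_apply, ContinuousLinearMap.comp_apply, hrepr]
    simp [vec_inner_eq, Matrix.dotProduct_mulVec, Matrix.mulVec_transpose]
  have e3 : (((innerSL ℝ p).comp M.est + c • M.resid).comp (ContinuousLinearMap.inr ℝ _ _)).comp
      (ContinuousLinearMap.inr ℝ _ _) = innerSL ℝ c := by
    ext
    rw [ContinuousLinearMap.comp_apply, ContinuousLinearMap.comp_apply, hrepr]
    simp
  rw [Params.armLaw, charFunDual_prod, charFunDual_prod, e1, e2, e3,
    charFunDual_multivariateGaussian_innerSL M.posDef_covX.posSemidef,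
    charFunDual_multivariateGaussian_innerSL M.posDef_covY.posSemidef,
    charFunDual_gaussianReal_innerSL, ← Complex.exp_add, ← Complex.exp_add]
  congr 1
  rw [← add_div, ← add_div, ← neg_add, ← neg_add, ← Complex.ofReal_add, ← Complex.ofReal_add]
  congr 3
  set G := M.D * (M.A * M.covX * M.A.transpose + M.covY) * M.D.transpose with hG
  have g1 : M.D * M.A * M.covX = G := M.D_mul_covX
  have g2 : M.covX * (M.D * M.A).transpose = G := by
    rw [hG, M.D_mul, Matrix.transpose_mul, Matrix.mul_assoc]
  have g1' : M.D * (M.A * M.covX) = G := by rw [← Matrix.mul_assoc, g1]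
  have g3 : M.D * (M.A * G) + M.D * M.covY * M.D.transpose = G := by
    conv_rhs => rw [hG, mul_add, add_mul]
    rw [← g2, Matrix.transpose_mul]
    simp only [Matrix.mul_assoc]
  have q1 : ∀ (K : Matrix (Fin d) (Fin d) ℝ) (a b : Fin d → ℝ),
      K.transpose.mulVec a ⬝ᵥ b = a ⬝ᵥ K.mulVec b := by
    intro K a b
    rw [Matrix.mulVec_transpose, Matrix.dotProduct_mulVec]
  have q2 : ((M.D * M.A).transpose.mulVec w + c • M.μstar.ofLp) ⬝ᵥ
        M.covX.mulVec ((M.D * M.A).transpose.mulVec w + c • M.μstar.ofLp) =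
      w ⬝ᵥ (M.D * (M.A * G)).mulVec w + c * w ⬝ᵥ G.mulVec M.μstar.ofLp
        + c * M.μstar.ofLp ⬝ᵥ G.mulVec w
        + c ^ 2 * M.μstar.ofLp ⬝ᵥ M.covX.mulVec M.μstar.ofLp := by
    simp only [Matrix.mulVec_add, Matrix.mulVec_smul, add_dotProduct, dotProduct_add,
      smul_dotProduct, dotProduct_smul, smul_eq_mul, q1, Matrix.mulVec_mulVec, g2, g1',
      Matrix.mul_assoc]
    ring
  have q3 : M.D.transpose.mulVec w ⬝ᵥ M.covY.mulVec (M.D.transpose.mulVec w) =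
      w ⬝ᵥ (M.D * M.covY * M.D.transpose).mulVec w := by
    simp only [q1, Matrix.mulVec_mulVec, ← Matrix.mul_assoc]
  have q4 : w ⬝ᵥ G.mulVec w = w ⬝ᵥ (M.D * (M.A * G)).mulVec w +
      w ⬝ᵥ (M.D * M.covY * M.D.transpose).mulVec w := by
    rw [← dotProduct_add, ← Matrix.add_mulVec, g3]
  rw [q2, q3, hp]
  simp only [Matrix.mulVec_add, Matrix.mulVec_smul, add_dotProduct, dotProduct_add,
      smul_dotProduct, dotProduct_smul, smul_eq_mul, q4]
  ring

/-- The context estimate and the prediction error of an arm have the same joint law as the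
context estimate and the negative of the prediction error. -/
theorem Params.map_armLaw_est_neg_resid (M : Params d) :
    M.armLaw.map (fun z => (M.est z, -M.resid z)) =
      M.armLaw.map (fun z => (M.est z, M.resid z)) := by
  have key : ∀ (s : ℝ) (L : StrongDual ℝ (Vec d × ℝ)), charFunDual
      (M.armLaw.map (M.est.prod (s • M.resid))) L = charFunDual M.armLaw
        ((innerSL ℝ ((InnerProductSpace.toDual ℝ (Vec d)).symm
          (L.comp (ContinuousLinearMap.inl ℝ _ _)))).comp M.est + (s * L (0, 1)) • M.resid) := by
    intro s L
    rw [charFunDual_map]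
    congr 1
    refine ContinuousLinearMap.ext fun z => ?_
    have : (M.est z, s • M.resid z) =
        (M.est z, (0 : ℝ)) + (s * M.resid z) • ((0 : Vec d), (1 : ℝ)) := by
      simp
    change L (M.est z, s • M.resid z) = inner ℝ ((InnerProductSpace.toDual ℝ (Vec d)).symm
      (L.comp (ContinuousLinearMap.inl ℝ _ _))) (M.est z) + (s * L (0, 1)) * M.resid z
    rw [this, map_add, map_smul, InnerProductSpace.toDual_symm_apply]
    simp
    ring
  have h1 : (fun z => (M.est z, -M.resid z)) = M.est.prod ((-1 : ℝ) • M.resid) := by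
    funext z; simp
  have h2 : (fun z => (M.est z, M.resid z)) = M.est.prod ((1 : ℝ) • M.resid) := by
    funext z; simp
  rw [h1, h2]
  have m1 : IsProbabilityMeasure (M.armLaw.map (M.est.prod ((-1 : ℝ) • M.resid))) :=
    Measure.isProbabilityMeasure_map (by fun_prop)
  have m2 : IsProbabilityMeasure (M.armLaw.map (M.est.prod ((1 : ℝ) • M.resid))) :=
    Measure.isProbabilityMeasure_map (by fun_prop)
  refine Measure.ext_of_charFunDual ?_
  funext L
  -- The factors `s = -1` and `s = 1` enter the exponent only through the square of `s * L (0, 1)`.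
  rw [key, key, M.charFunDual_armLaw, M.charFunDual_armLaw]
  norm_num

theorem Params.map_envLaw_est_neg_resid (M : Params d) :
    (M.envLaw N).map (fun e i => (M.est (e i), -M.resid (e i))) =
      (M.envLaw N).map (fun e i => (M.est (e i), M.resid (e i))) := by
  have m1 : IsProbabilityMeasure (M.armLaw.map (fun z => (M.est z, -M.resid z))) :=
    Measure.isProbabilityMeasure_map (by fun_prop)
  have m2 : IsProbabilityMeasure (M.armLaw.map (fun z => (M.est z, M.resid z))) :=
    Measure.isProbabilityMeasure_map (by fun_prop)
  rw [M.envLaw_eq, Measure.pi_map_pi (f := fun _ z => (M.est z, -M.resid z)),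
    Measure.pi_map_pi (f := fun _ z => (M.est z, M.resid z)), M.map_armLaw_est_neg_resid]
  all_goals intro i; fun_prop

theorem multivariateGaussian_inner_eq_null {m : Vec d} {S : Matrix (Fin d) (Fin d) ℝ}
    (hS : S.PosDef) {u : Vec d} (hu : u ≠ 0) (c : ℝ) :
    multivariateGaussian m S {x | inner ℝ u x = c} = 0 := by
  have hmap := IsGaussian.map_eq_gaussianReal (μ := multivariateGaussian m S) (innerSL ℝ u)
  have hvar : Var[innerSL ℝ u; multivariateGaussian m S] = u.ofLp ⬝ᵥ S.mulVec u.ofLp := by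
    rw [← covarianceBilin_multivariateGaussian (μ := m) hS.posSemidef, covarianceBilin_self
      IsGaussian.memLp_two_id]
    rfl
  have hpos : 0 < u.ofLp ⬝ᵥ S.mulVec u.ofLp := by
    have := hS.dotProduct_mulVec_pos (x := u.ofLp) (by simpa using hu)
    simpa using this
  have hna : NullSingletonClass ((multivariateGaussian m S).map (innerSL ℝ u)) := by
    rw [hmap]
    refine nullSingletonClass_gaussianReal ?_
    rw [hvar]
    simpa using hpos
  have := measure_singleton (μ := (multivariateGaussian m S).map (innerSL ℝ u)) c
  rwa [Measure.map_apply (by fun_prop) (measurableSet_singleton c)] at this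

/-- For a fixed context, the output noise alone already gives the component along `u` an atomless
law, because `D` is invertible. -/
theorem Params.armLaw_inner_est_eq_null (M : Params d) {u : Vec d} (hu : u ≠ 0) (c : ℝ) :
    M.armLaw {z | inner ℝ u (M.est z) = c} = 0 := by
  have hu' : (WithLp.toLp 2 (M.D.transpose.mulVec u.ofLp) : Vec d) ≠ 0 := by
    intro h
    have h' : M.D.transpose.mulVec u.ofLp = 0 := by simpa using h
    have hDT : IsUnit M.D.transpose.det := by rw [Matrix.det_transpose]; exact M.isUnit_det_D
    exact hu (by simpa using Matrix.eq_zero_of_mulVec_eq_zero hDT.ne_zero h')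
  have hmeas : MeasurableSet {z | inner ℝ u (M.est z) = c} := by
    refine measurableSet_eq_fun ?_ measurable_const
    fun_prop
  rw [Params.armLaw, Measure.measure_prod_null hmeas]
  refine Eventually.of_forall fun x => ?_
  have e : Prod.mk x ⁻¹' {z | inner ℝ u (M.est z) = c} = Prod.fst ⁻¹' {y : Vec d |
      inner ℝ (WithLp.toLp 2 (M.D.transpose.mulVec u.ofLp) : Vec d) y =
        c - u.ofLp ⬝ᵥ M.D.mulVec (M.A.mulVec x.ofLp)} := by
    ext y
    simp only [Set.mem_preimage, Set.mem_ofPred_eq, vec_inner_eq, M.est_ofLp, Matrix.mulVec_add,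
      dotProduct_add]
    rw [Matrix.mulVec_transpose, Matrix.dotProduct_mulVec u.ofLp _ y.1.ofLp, eq_sub_iff_add_eq,
      add_comm]
  simp only [e, Pi.zero_apply]
  exact Measure.quasiMeasurePreserving_fst.preimage_null
    (multivariateGaussian_inner_eq_null M.posDef_covY hu' _)

/-- The mean squared distance from `m` is the trace of the covariance matrix. -/
theorem multivariateGaussian_chebyshev (m : Vec d) {S : Matrix (Fin d) (Fin d) ℝ}
    (hS : S.PosSemidef) {ε : ℝ} (hε : 0 < ε) :
    (multivariateGaussian m S).real {x | ε ≤ ‖x - m‖} ≤ S.trace / ε ^ 2 := by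
  have hL : MemLp (fun x : Vec d => x - m) 2 (multivariateGaussian m S) :=
    IsGaussian.memLp_two_id.sub (memLp_const m)
  have hLi : ∀ i, MemLp (fun x : Vec d => x i - m i) 2 (multivariateGaussian m S) := by
    intro i
    have : MemLp (fun x : Vec d => x i) 2 (multivariateGaussian m S) :=
      (EuclideanSpace.proj (𝕜 := ℝ) i).comp_memLp' IsGaussian.memLp_two_id
    exact this.sub (memLp_const _)
  have hm : ∀ i, ∫ x : Vec d, x i ∂(multivariateGaussian m S) = m i := by
    intro i
    have := (EuclideanSpace.proj i : Vec d →L[ℝ] ℝ).integral_comp_comm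
      (IsGaussian.integrable_id (μ := multivariateGaussian m S))
    simpa using this
  have h1 : ∫ x, ‖x - m‖ ^ 2 ∂(multivariateGaussian m S) = S.trace := by
    simp only [EuclideanSpace.real_norm_sq_eq, PiLp.sub_apply]
    rw [integral_finsetSum _ fun i _ => (hLi i).integrable_sq]
    refine Finset.sum_congr rfl fun i _ => ?_
    have h := variance_eval_multivariateGaussian (μ := m) hS i
    rw [variance_eq_integral (by fun_prop), hm i] at h
    simpa using h
  have h2 := mul_meas_ge_le_integral_of_nonneg (μ := multivariateGaussian m S)
    (f := fun x => ‖x - m‖ ^ 2) (Eventually.of_forall fun x => by positivity)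
    (hL.integrable_norm_pow two_ne_zero) (ε ^ 2)
  rw [h1] at h2
  rw [le_div_iff₀ (by positivity), mul_comm]
  refine le_trans (mul_le_mul_of_nonneg_left (measureReal_mono fun x hx => ?_) (by positivity)) h2
  exact pow_le_pow_left₀ hε.le hx 2

end

/-! ### Quadratic forms, and the regression identity for the posterior mean -/

section

variable {d N : ℕ}

theorem le_quadForm_of_unit {C : Matrix (Fin d) (Fin d) ℝ} {c : ℝ}
    (h : ∀ u : Vec d, ‖u‖ = 1 → c ≤ u.ofLp ⬝ᵥ C.mulVec u.ofLp) (u : Vec d) :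
    c * ‖u‖ ^ 2 ≤ u.ofLp ⬝ᵥ C.mulVec u.ofLp := by
  rcases eq_or_ne u 0 with rfl | hu
  · simp
  · have hn : ‖u‖ ≠ 0 := norm_ne_zero_iff.2 hu
    have := h (‖u‖⁻¹ • u) (by rw [norm_smul, norm_inv, norm_norm, inv_mul_cancel₀ hn])
    rw [WithLp.ofLp_smul, Matrix.mulVec_smul, smul_dotProduct, dotProduct_smul, smul_eq_mul,
      smul_eq_mul, ← mul_assoc] at this
    calc c * ‖u‖ ^ 2 ≤ ‖u‖⁻¹ * ‖u‖⁻¹ * (u.ofLp ⬝ᵥ C.mulVec u.ofLp) * ‖u‖ ^ 2 := by gcongr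
      _ = _ := by field_simp

theorem continuous_quadForm (C : Matrix (Fin d) (Fin d) ℝ) :
    Continuous fun u : Vec d => u.ofLp ⬝ᵥ C.mulVec u.ofLp := by
  have h : Continuous fun u : Vec d => C.mulVec u.ofLp :=
    continuous_const.matrix_mulVec (PiLp.continuous_ofLp 2 _)
  exact (PiLp.continuous_ofLp 2 _).dotProduct h

theorem exists_pos_le_quadForm {C : Matrix (Fin d) (Fin d) ℝ} (hC : C.PosDef) :
    ∃ c > 0, ∀ u : Vec d, c * ‖u‖ ^ 2 ≤ u.ofLp ⬝ᵥ C.mulVec u.ofLp := by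
  -- The sphere is empty when `d = 0`; any constant serves then.
  rcases (Metric.sphere (0 : Vec d) 1).eq_empty_or_nonempty with he | hne
  · refine ⟨1, one_pos, le_quadForm_of_unit fun u hu => ?_⟩
    have : u ∈ Metric.sphere (0 : Vec d) 1 := by simpa using hu
    simp [he] at this
  · obtain ⟨v, hv, hmin⟩ := (isCompact_sphere (0 : Vec d) 1).exists_isMinOn hne
      (continuous_quadForm C).continuousOn
    refine ⟨v.ofLp ⬝ᵥ C.mulVec v.ofLp, ?_, le_quadForm_of_unit fun u hu => hmin (by simpa using hu)⟩
    have hv0 : v ≠ 0 := by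
      rintro rfl
      simp at hv
    have := hC.dotProduct_mulVec_pos (x := v.ofLp) (by simpa using hv0)
    simpa using this

/-- Cauchy–Schwarz: `c ‖u‖² ≤ ⟨u, C u⟩ = ⟨u, w⟩ ≤ ‖u‖ ‖w‖`. -/
theorem norm_le_of_quadForm_lower_bound {C : Matrix (Fin d) (Fin d) ℝ} {c : ℝ} (hc : 0 < c)
    (h : ∀ u : Vec d, c * ‖u‖ ^ 2 ≤ u.ofLp ⬝ᵥ C.mulVec u.ofLp) {u w : Vec d}
    (hw : C.mulVec u.ofLp = w.ofLp) : ‖u‖ ≤ ‖w‖ / c := by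
  rw [le_div_iff₀ hc, mul_comm]
  rcases eq_or_ne ‖u‖ 0 with hu | hu
  · rw [hu, mul_zero]; positivity
  · have h1 := h u
    rw [hw, ← vec_inner_eq] at h1
    have h2 := real_inner_le_norm u w
    have h3 : 0 < ‖u‖ := lt_of_le_of_ne (norm_nonneg _) hu.symm
    nlinarith

theorem trace_inv_le_of_quadForm_lower_bound {C : Matrix (Fin d) (Fin d) ℝ} (hC : C.PosDef) {c : ℝ}
    (hc : 0 < c) (h : ∀ u : Vec d, c * ‖u‖ ^ 2 ≤ u.ofLp ⬝ᵥ C.mulVec u.ofLp) :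
    C⁻¹.trace ≤ d / c := by
  have hdet : IsUnit C.det := hC.det_pos.ne'.isUnit
  have : ∀ i, C⁻¹ i i ≤ 1 / c := by
    intro i
    let e : Vec d := EuclideanSpace.single i 1
    have h1 := norm_le_of_quadForm_lower_bound hc h 
      (u := WithLp.toLp 2 (C⁻¹.mulVec e.ofLp)) (w := e)
      (by simp [Matrix.mulVec_mulVec, Matrix.mul_nonsing_inv _ hdet])
    have h2 : (WithLp.toLp 2 (C⁻¹.mulVec e.ofLp) : Vec d) i = C⁻¹ i i := by simp [e]
    have h3 := PiLp.norm_apply_le (WithLp.toLp 2 (C⁻¹.mulVec e.ofLp) : Vec d) i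
    rw [h2, Real.norm_eq_abs] at h3
    have h4 : ‖e‖ = 1 := by simp [e]
    rw [h4] at h1
    exact (le_abs_self _).trans (h3.trans h1)
  calc C⁻¹.trace = ∑ i, C⁻¹ i i := rfl
    _ ≤ ∑ _i : Fin d, 1 / c := Finset.sum_le_sum fun i _ => this i
    _ = d / c := by simp [div_eq_mul_inv]

namespace Run

variable {Ω : Type*} (R : Run Ω d N) (M : Params d) (Sig : Matrix (Fin d) (Fin d) ℝ)

/-- The data of the selected arm. -/
def sel (n : ℕ) (ω : Ω) : Vec d × Vec d × ℝ := R.env n ω (R.arm n ω)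

theorem xhat_eq (n : ℕ) (i : Fin N) (ω : Ω) : R.xhat M n i ω = M.est (R.env n ω i) := by
  apply WithLp.ofLp_injective
  rw [M.est_ofLp]
  rfl

theorem xhatSel_eq (n : ℕ) (ω : Ω) : R.xhatSel M n ω = M.est (R.sel n ω) := R.xhat_eq M n _ ω

/-- This turns the bandit into linear regression on the observed estimate, with `resid` as noise. -/
theorem rewardSel_eq (n : ℕ) (ω : Ω) :
    R.rewardSel M n ω = inner ℝ (M.est (R.sel n ω)) M.μstar + M.resid (R.sel n ω) := by
  have h : M.resid (R.sel n ω) = inner ℝ M.μstar (R.sel n ω).1 + (R.sel n ω).2.2 -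
    inner ℝ M.μstar (M.est (R.sel n ω)) := rfl
  rw [h, real_inner_comm M.μstar]
  simp [rewardSel, reward, sel, env, real_inner_comm M.μstar]

theorem quadForm_B (n : ℕ) (ω : Ω) (u : Vec d) :
    u.ofLp ⬝ᵥ (R.B M Sig n ω).mulVec u.ofLp = u.ofLp ⬝ᵥ Sig⁻¹.mulVec u.ofLp +
      ∑ s ∈ Finset.range n, (inner ℝ u (M.est (R.sel s ω))) ^ 2 := by
  induction n with
  | zero => simp [B]
  | succ n ih =>
    rw [B, Matrix.add_mulVec, dotProduct_add, ih, Finset.sum_range_succ, add_assoc, xhatSel_eq,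
      vec_inner_eq u (M.est (R.sel n ω)), Matrix.vecMulVec_mulVec, dotProduct_smul]
    simp only [op_smul_eq_smul, smul_eq_mul]
    rw [dotProduct_comm (M.est (R.sel n ω)).ofLp, sq]

variable {Sig}

theorem posDef_B (hSig : Sig.PosDef) (n : ℕ) (ω : Ω) : (R.B M Sig n ω).PosDef := by
  induction n with
  | zero => exact hSig.inv
  | succ n ih =>
    have := Matrix.posSemidef_vecMulVec_self_star (R.xhatSel M n ω).ofLp
    exact ih.add_posSemidef (by simpa using this)

theorem le_quadForm_B {c : ℝ} (h : ∀ u : Vec d, c * ‖u‖ ^ 2 ≤ u.ofLp ⬝ᵥ Sig⁻¹.mulVec u.ofLp)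
    (n : ℕ) (ω : Ω) (u : Vec d) : c * ‖u‖ ^ 2 ≤ u.ofLp ⬝ᵥ (R.B M Sig n ω).mulVec u.ofLp := by
  rw [quadForm_B]
  exact (h u).trans (le_add_of_nonneg_right (Finset.sum_nonneg fun _ _ => sq_nonneg _))

/-- The accumulated products of selected context estimates and prediction errors. -/
def score (n : ℕ) (ω : Ω) : Vec d :=
  ∑ s ∈ Finset.range n, M.resid (R.sel s ω) • M.est (R.sel s ω)

/-- The rank-one term added to `B` cancels the part `⟨est, μstar⟩` of the reward, so each round adds
only `resid • est`. The constant `-Sig⁻¹ μstar` is the bias of the prior mean `0`. -/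
theorem B_mulVec_muHat_sub (hSig : Sig.PosDef) (n : ℕ) (ω : Ω) :
    (R.B M Sig n ω).mulVec (R.muHat M Sig n ω - M.μstar).ofLp =
      (R.score M n ω - WithLp.toLp 2 (Sig⁻¹.mulVec M.μstar.ofLp)).ofLp := by
  induction n with
  | zero => simp [B, muHat, score, Matrix.mulVec_neg]
  | succ n ih =>
    have hdet : IsUnit (R.B M Sig (n + 1) ω).det := (R.posDef_B M hSig (n + 1) ω).det_pos.ne'.isUnit
    have hs : R.score M (n + 1) ω = R.score M n ω + M.resid (R.sel n ω) • M.est (R.sel n ω) :=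
      Finset.sum_range_succ _ _
    rw [WithLp.ofLp_sub, Matrix.mulVec_sub, sub_eq_iff_eq_add] at ih
    rw [muHat, WithLp.ofLp_sub, Matrix.mulVec_sub, Matrix.mulVec_mulVec,
      Matrix.mul_nonsing_inv _ hdet, Matrix.one_mulVec, ih, B, Matrix.add_mulVec,
      Matrix.vecMulVec_mulVec, rewardSel_eq, xhatSel_eq, vec_inner_eq, hs]
    simp only [op_smul_eq_smul, WithLp.ofLp_sub, WithLp.ofLp_add, WithLp.ofLp_smul, add_smul]
    abel

theorem norm_muHat_sub_le (hSig : Sig.PosDef) {n : ℕ} {ω : Ω} {c : ℝ} (hc : 0 < c)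
    (h : ∀ u : Vec d, c * ‖u‖ ^ 2 ≤ u.ofLp ⬝ᵥ (R.B M Sig n ω).mulVec u.ofLp) :
    ‖R.muHat M Sig n ω - M.μstar‖ ≤
      ‖R.score M n ω - WithLp.toLp 2 (Sig⁻¹.mulVec M.μstar.ofLp)‖ / c :=
  norm_le_of_quadForm_lower_bound hc h (R.B_mulVec_muHat_sub M hSig n ω)

end Run

end

/-! ### Linear growth of the precision matrix -/

section

variable {d N : ℕ}

/-- If `u ≠ 0`, then with positive probability all context estimates of a round are bounded and
have components along `u` bounded away from zero. -/
theorem Params.exists_envLaw_pos (M : Params d) {u : Vec d} (hu : u ≠ 0) :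
    ∃ δ > 0, 0 < (M.envLaw N).real
      {e | ∀ i, 2 * δ ≤ |inner ℝ u (M.est (e i))| ∧ ‖M.est (e i)‖ ≤ δ⁻¹} := by
  -- If every `δ = 1 / (k + 1)` failed, almost every `e` would violate the bounds for all `k`; but
  -- where no component along `u` vanishes, all small `δ` satisfy them.
  by_contra! hcon
  have hnull : ∀ k : ℕ, M.envLaw N {e | ∀ i, 2 * ((k : ℝ) + 1)⁻¹ ≤ |inner ℝ u (M.est (e i))| ∧
      ‖M.est (e i)‖ ≤ (((k : ℝ) + 1)⁻¹)⁻¹} = 0 := fun k =>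
    (measureReal_eq_zero_iff).1 (le_antisymm (hcon _ (by positivity)) measureReal_nonneg)
  have h1 : ∀ᵐ e ∂(M.envLaw N), ∀ i, inner ℝ u (M.est (e i)) ≠ 0 := by
    rw [ae_all_iff]
    intro i
    have hq : Measure.QuasiMeasurePreserving (Function.eval i) (M.envLaw N) M.armLaw :=
      Measure.quasiMeasurePreserving_eval (μ := fun _ : Fin N => M.armLaw) i
    exact hq.ae (compl_mem_ae_iff.2 (M.armLaw_inner_est_eq_null hu 0))
  have h2 := ae_all_iff.2 fun k => compl_mem_ae_iff.2 (hnull k)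
  obtain ⟨e, he1, he2⟩ := (h1.and h2).exists
  have h3 : ∀ᶠ δ : ℝ in 𝓝[>] 0, ∀ i, 2 * δ ≤ |inner ℝ u (M.est (e i))| ∧ ‖M.est (e i)‖ ≤ δ⁻¹ := by
    rw [eventually_all]
    intro i
    refine Eventually.and ?_ (tendsto_inv_nhdsGT_zero.eventually_ge_atTop _)
    have : Tendsto (fun δ : ℝ => 2 * δ) (𝓝[>] 0) (𝓝 0) := by
      have h := (continuous_const_mul (2 : ℝ)).tendsto 0
      rw [mul_zero] at h
      exact h.mono_left nhdsWithin_le_nhds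
    exact this.eventually_le_const (abs_pos.2 (he1 i))
  have h4 : Tendsto (fun k : ℕ => ((k : ℝ) + 1)⁻¹) atTop (𝓝[>] 0) := by
    refine tendsto_nhdsWithin_iff.2 ⟨?_, Eventually.of_forall fun k => ?_⟩
    · simpa using tendsto_one_div_add_atTop_nhds_zero_nat (𝕜 := ℝ)
    · simp only [Set.mem_Ioi]; positivity
  obtain ⟨k, hk⟩ := (h4.eventually h3).exists
  exact he2 k hk

namespace Run

variable {Ω : Type*} (R : Run Ω d N) {M : Params d} {Sig : Matrix (Fin d) (Fin d) ℝ}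

theorem measurable_step_history {k n : ℕ} (h : k < n) :
    Measurable[R.history n] (fun ω => (R.env k ω, R.draw k ω, R.arm k ω)) := by
  rw [measurable_iff_comap_le]
  exact le_iSup (fun k : Fin n => MeasurableSpace.comap
    (fun ω => (R.env k ω, R.draw k ω, R.arm k ω)) inferInstance) ⟨k, h⟩

theorem history_mono : Monotone R.history := by
  intro m n hmn
  exact iSup_le fun k => (R.measurable_step_history (k.2.trans_le hmn)).comap_le

theorem measurable_env_history {k n : ℕ} (h : k < n) : Measurable[R.history n] (R.env k) :=
  measurable_fst.comp (R.measurable_step_history h)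

theorem measurable_draw_history {k n : ℕ} (h : k < n) : Measurable[R.history n] (R.draw k) :=
  measurable_fst.comp (measurable_snd.comp (R.measurable_step_history h))

theorem measurable_sel_history {k n : ℕ} (h : k < n) : Measurable[R.history n] (R.sel k) := by
  have h1 : Measurable (fun p : (Fin N → Vec d × Vec d × ℝ) × Vec d × Fin N => p.1 p.2.2) := by
    have : Measurable (fun p : (Fin N → Vec d × Vec d × ℝ) × Fin N => p.1 p.2) :=
      measurable_from_prod_countable_left fun i => measurable_pi_apply i
    exact this.comp (measurable_fst.prodMk (measurable_snd.comp measurable_snd))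
  exact h1.comp (R.measurable_step_history h)

namespace IsThompsonSampling

variable {R} [mΩ : MeasurableSpace Ω] {P : Measure Ω}

theorem measurable_env (hR : R.IsThompsonSampling M Sig P) (n : ℕ) : Measurable (R.env n) :=
  measurable_pi_lambda _ fun i =>
    (hR.measurable_x n i).prodMk ((hR.measurable_noiseY n i).prodMk (hR.measurable_noiseR n i))

theorem history_le (hR : R.IsThompsonSampling M Sig P) (n : ℕ) : R.history n ≤ mΩ :=
  iSup_le fun k => ((hR.measurable_env k).prodMk
    ((hR.measurable_draw k).prodMk (hR.measurable_arm k))).comap_le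

theorem measurable_sel (hR : R.IsThompsonSampling M Sig P) (n : ℕ) : Measurable (R.sel n) :=
  (R.measurable_sel_history n.lt_succ_self).mono (hR.history_le _) le_rfl

theorem indep_env_history (hR : R.IsThompsonSampling M Sig P) (n : ℕ) :
    Indep (MeasurableSpace.comap (R.env n) inferInstance) (R.history n) P :=
  indep_of_indep_of_le_right (hR.indep_env n) le_sup_left

variable [IsProbabilityMeasure P]

/-- Independence across rounds is not assumed outright; it comes from peeling off the last round,
which is independent of its past. -/
theorem integral_prod_env (hR : R.IsThompsonSampling M Sig P)
    {g : (Fin N → Vec d × Vec d × ℝ) → ℝ} (hg : Measurable g) (n : ℕ) :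
    ∫ ω, ∏ s ∈ Finset.range n, g (R.env s ω) ∂P = (∫ e, g e ∂(M.envLaw N)) ^ n := by
  induction n with
  | zero => simp
  | succ n ih =>
    have hZ : Measurable[R.history n] (fun ω => ∏ s ∈ Finset.range n, g (R.env s ω)) :=
      Finset.measurable_fun_prod _ fun s hs =>
        hg.comp (R.measurable_env_history (Finset.mem_range.1 hs))
    have hY : Measurable[MeasurableSpace.comap (R.env n) inferInstance] (fun ω => g (R.env n ω)) :=
      hg.comp (comap_measurable _)
    have hind : IndepFun (fun ω => ∏ s ∈ Finset.range n, g (R.env s ω))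
        (fun ω => g (R.env n ω)) P :=
      indep_of_indep_of_le_left (indep_of_indep_of_le_right (hR.indep_env_history n).symm
        hY.comap_le) hZ.comap_le
    have hgn : ∫ ω, g (R.env n ω) ∂P = ∫ e, g e ∂(M.envLaw N) := by
      rw [← hR.map_env n, integral_map (hR.measurable_env n).aemeasurable hg.aestronglyMeasurable]
    simp only [Finset.prod_range_succ]
    rw [hind.integral_fun_mul_eq_mul_integral
      (hZ.mono (hR.history_le n) le_rfl).aestronglyMeasurable
      (hg.comp (hR.measurable_env n)).aestronglyMeasurable, ih, hgn, pow_succ]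

/-- Near a nonzero direction, the precision grows linearly up to exponentially small
probability. -/
theorem exists_local_lower_bound (hR : R.IsThompsonSampling M Sig P) (hSig : Sig.PosDef)
    {u : Vec d} (hu : u ≠ 0) :
    ∃ U ∈ 𝓝 u, ∃ c > 0, ∃ ρ : ℝ, 0 < ρ ∧ ρ < 1 ∧ ∀ n : ℕ,
      P.real {ω | ∃ v ∈ U, v.ofLp ⬝ᵥ (R.B M Sig n ω).mulVec v.ofLp < c * n} ≤ ρ ^ n := by
  obtain ⟨δ, hδ, hp⟩ := M.exists_envLaw_pos (N := N) hu
  set Ev : Set (Fin N → Vec d × Vec d × ℝ) :=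
    {e | ∀ i, 2 * δ ≤ |inner ℝ u (M.est (e i))| ∧ ‖M.est (e i)‖ ≤ δ⁻¹} with hEv
  have hEvm : MeasurableSet Ev := by
    rw [hEv]
    simp only [measurableSet_setOfPred]
    refine Measurable.forall fun i => Measurable.and ?_ ?_
    · exact measurableSet_setOfPred.1 (measurableSet_le (by fun_prop) (by fun_prop))
    · exact measurableSet_setOfPred.1 (measurableSet_le (by fun_prop) (by fun_prop))
  -- Chernoff's method: the mean `q` of `exp(-1_Ev)` is less than `1`, and products over rounds have
  -- mean `q ^ n`.
  let g : (Fin N → Vec d × Vec d × ℝ) → ℝ := fun e => Real.exp (-(Ev.indicator 1 e))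
  have hgm : Measurable g := by
    have : Measurable (Ev.indicator (1 : (Fin N → Vec d × Vec d × ℝ) → ℝ)) :=
      measurable_one.indicator hEvm
    exact Real.measurable_exp.comp this.neg
  set q := ∫ e, g e ∂(M.envLaw N) with hq
  have hg_eq : g = fun e => 1 - Ev.indicator (fun _ => 1 - Real.exp (-1)) e := by
    funext e
    by_cases he : e ∈ Ev <;> simp [g, he]
  have hq_eq : q = 1 - (M.envLaw N).real Ev * (1 - Real.exp (-1)) := by
    rw [hq, hg_eq, integral_sub (integrable_const _) ((integrable_const _).indicator hEvm),
      integral_indicator_const _ hEvm]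
    simp
  have hexp : Real.exp (-1) < 1 := by simp
  have hexp0 : 0 < Real.exp (-1) := Real.exp_pos _
  have hp1 : (M.envLaw N).real Ev ≤ 1 := measureReal_le_one
  have hq1 : q < 1 := by rw [hq_eq]; nlinarith
  have hq0 : 0 < q := by rw [hq_eq]; nlinarith
  have hlog : Real.log q < 0 := Real.log_neg hq0 hq1
  -- On `Ev`, moving `u` by `δ ^ 2` changes components by at most `δ ^ 2 * δ⁻¹ = δ`, leaving at
  -- least `δ` of `2 * δ`. Asking for fewer than `n * (-log q / 2)` occurrences costs a factor `q ^
  -- (-n / 2)` in Markov's inequality, whence the rate `ρ = √q`.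
  refine ⟨Metric.ball u (δ ^ 2), Metric.ball_mem_nhds _ (by positivity),
    δ ^ 2 * (-Real.log q / 2), by nlinarith [sq_pos_of_pos hδ], Real.exp (Real.log q / 2),
    Real.exp_pos _, by simpa using by linarith, fun n => ?_⟩
  have hsub : {ω | ∃ v ∈ Metric.ball u (δ ^ 2), v.ofLp ⬝ᵥ (R.B M Sig n ω).mulVec v.ofLp <
      δ ^ 2 * (-Real.log q / 2) * n} ⊆
      {ω | Real.exp (n * (Real.log q / 2)) ≤ ∏ s ∈ Finset.range n, g (R.env s ω)} := by
    rintro ω ⟨v, hv, hlt⟩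
    have h1 : ∀ s, δ ^ 2 * Ev.indicator 1 (R.env s ω) ≤ (inner ℝ v (M.est (R.sel s ω))) ^ 2 := by
      intro s
      by_cases he : R.env s ω ∈ Ev
      · obtain ⟨h2, h3⟩ := he (R.arm s ω)
        change 2 * δ ≤ |inner ℝ u (M.est (R.sel s ω))| at h2
        change ‖M.est (R.sel s ω)‖ ≤ δ⁻¹ at h3
        rw [Set.indicator_of_mem he, Pi.one_apply, mul_one, ← sq_abs (inner ℝ v _)]
        refine pow_le_pow_left₀ hδ.le ?_ 2
        have h4 : |inner ℝ (u - v) (M.est (R.sel s ω))| ≤ δ := by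
          refine (abs_real_inner_le_norm _ _).trans ?_
          have : ‖u - v‖ ≤ δ ^ 2 := by
            rw [← dist_eq_norm, dist_comm]; exact (Metric.mem_ball.1 hv).le
          calc ‖u - v‖ * ‖M.est (R.sel s ω)‖ ≤ δ ^ 2 * δ⁻¹ := by gcongr
            _ = δ := by field_simp
        rw [inner_sub_left] at h4
        have := abs_sub_abs_le_abs_sub (inner ℝ u (M.est (R.sel s ω)))
          (inner ℝ v (M.est (R.sel s ω)))
        linarith
      · rw [Set.indicator_of_notMem he, mul_zero]; positivity
    have h5 : δ ^ 2 * ∑ s ∈ Finset.range n, Ev.indicator 1 (R.env s ω) <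
        δ ^ 2 * (-Real.log q / 2) * n := by
      refine lt_of_le_of_lt ?_ hlt
      rw [quadForm_B, Finset.mul_sum]
      have h6 : 0 ≤ v.ofLp ⬝ᵥ Sig⁻¹.mulVec v.ofLp := by
        simpa using hSig.inv.posSemidef.dotProduct_mulVec_nonneg v.ofLp
      have h7 := Finset.sum_le_sum fun s (_ : s ∈ Finset.range n) => h1 s
      linarith
    rw [mul_assoc] at h5
    have h8 := lt_of_mul_lt_mul_left h5 (by positivity)
    simp only [Set.mem_ofPred_eq, g, ← Real.exp_sum, Finset.sum_neg_distrib]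
    refine Real.exp_le_exp.2 ?_
    linarith
  refine (measureReal_mono hsub).trans ?_
  have hint : Integrable (fun ω => ∏ s ∈ Finset.range n, g (R.env s ω)) P := by
    refine Integrable.of_bound (C := 1) (Finset.measurable_fun_prod _ fun s _ =>
      hgm.comp (hR.measurable_env s)).aestronglyMeasurable (Eventually.of_forall fun ω => ?_)
    rw [norm_prod]
    refine Finset.prod_le_one (fun _ _ => norm_nonneg _) fun s _ => ?_
    rw [Real.norm_eq_abs, abs_of_pos (Real.exp_pos _)]
    simp only [Real.exp_le_one_iff, Left.neg_nonpos_iff]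
    exact Set.indicator_nonneg (fun _ _ => zero_le_one) _
  have hmarkov := mul_meas_ge_le_integral_of_nonneg (μ := P)
    (f := fun ω => ∏ s ∈ Finset.range n, g (R.env s ω))
    (Eventually.of_forall fun ω => Finset.prod_nonneg fun _ _ => (Real.exp_pos _).le) hint
    (Real.exp (n * (Real.log q / 2)))
  rw [hR.integral_prod_env hgm, ← hq] at hmarkov
  have hqn : q ^ n = Real.exp (n * (Real.log q / 2)) * Real.exp (Real.log q / 2) ^ n := by
    rw [← Real.exp_nat_mul, ← Real.exp_add]
    conv_lhs => rw [← Real.exp_log hq0, ← Real.exp_nat_mul]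
    congr 1
    ring
  rw [hqn] at hmarkov
  exact le_of_mul_le_mul_left hmarkov (Real.exp_pos _)

/-- Up to exponentially small probability, the precision matrix is bounded below by a linearly
growing multiple of the identity. -/
theorem exists_lower_bound (hR : R.IsThompsonSampling M Sig P) (hSig : Sig.PosDef) :
    ∃ c > 0, ∃ ρ : ℝ, 0 < ρ ∧ ρ < 1 ∧ ∃ K : ℝ, 0 ≤ K ∧ ∀ n : ℕ,
      P.real {ω | ¬ ∀ u : Vec d, c * n * ‖u‖ ^ 2 ≤ u.ofLp ⬝ᵥ (R.B M Sig n ω).mulVec u.ofLp} ≤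
        K * ρ ^ n := by
  let p : Set (Vec d) → Prop := fun U => ∃ c > 0, ∃ ρ : ℝ, 0 < ρ ∧ ρ < 1 ∧ ∃ K : ℝ, 0 ≤ K ∧
    ∀ n : ℕ, P.real {ω | ∃ v ∈ U, v.ofLp ⬝ᵥ (R.B M Sig n ω).mulVec v.ofLp < c * n} ≤ K * ρ ^ n
  -- Compactness: finitely many neighbourhoods cover the sphere, and `p` survives unions with the
  -- smaller `c`, the larger `ρ` and the sum of the `K`.
  have hp : p (Metric.sphere 0 1) := by
    refine (isCompact_sphere (0 : Vec d) 1).induction_on (p := p) ?_ ?_ ?_ ?_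
    · exact ⟨1, one_pos, 1 / 2, by norm_num, by norm_num, 0, le_rfl, fun n => by simp⟩
    · rintro s t hst ⟨c, hc, ρ, h0, h1, K, hK, h⟩
      refine ⟨c, hc, ρ, h0, h1, K, hK, fun n => (measureReal_mono ?_).trans (h n)⟩
      rintro ω ⟨v, hv, hlt⟩
      exact ⟨v, hst hv, hlt⟩
    · rintro s t ⟨c, hc, ρ, h0, h1, K, hK, h⟩ ⟨c', hc', ρ', h0', h1', K', hK', h'⟩
      refine ⟨min c c', lt_min hc hc', max ρ ρ', lt_max_of_lt_left h0, max_lt h1 h1', K + K',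
        add_nonneg hK hK', fun n => ?_⟩
      have hsub : {ω | ∃ v ∈ s ∪ t, v.ofLp ⬝ᵥ (R.B M Sig n ω).mulVec v.ofLp < min c c' * n} ⊆
          {ω | ∃ v ∈ s, v.ofLp ⬝ᵥ (R.B M Sig n ω).mulVec v.ofLp < c * n} ∪
          {ω | ∃ v ∈ t, v.ofLp ⬝ᵥ (R.B M Sig n ω).mulVec v.ofLp < c' * n} := by
        rintro ω ⟨v, hv | hv, hlt⟩
        · refine Or.inl ⟨v, hv, hlt.trans_le ?_⟩
          gcongr; exact min_le_left _ _
        · refine Or.inr ⟨v, hv, hlt.trans_le ?_⟩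
          gcongr; exact min_le_right _ _
      refine (measureReal_mono hsub).trans ((measureReal_union_le _ _).trans ?_)
      rw [add_mul]
      refine add_le_add ((h n).trans ?_) ((h' n).trans ?_)
      · gcongr; exact le_max_left _ _
      · gcongr; exact le_max_right _ _
    · intro u hu
      have hu0 : u ≠ 0 := by
        rintro rfl
        simp at hu
      obtain ⟨U, hU, c, hc, ρ, h0, h1, h⟩ := hR.exists_local_lower_bound hSig hu0
      exact ⟨U, mem_nhdsWithin_of_mem_nhds hU, c, hc, ρ, h0, h1, 1, zero_le_one, fun n => by
        simpa using h n⟩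
  obtain ⟨c, hc, ρ, h0, h1, K, hK, h⟩ := hp
  refine ⟨c, hc, ρ, h0, h1, K, hK, fun n => (measureReal_mono ?_).trans (h n)⟩
  intro ω hω
  by_contra hcon
  simp only [Set.mem_ofPred_eq, not_exists, not_and, not_lt] at hcon
  exact hω (le_quadForm_of_unit fun u hu => hcon u (by simpa using hu))

/-- Almost surely, the precision matrix is eventually bounded below by a linearly growing multiple
of the identity. -/
theorem ae_eventually_lower_bound (hR : R.IsThompsonSampling M Sig P) (hSig : Sig.PosDef) :
    ∃ c > 0, ∀ᵐ ω ∂P, ∀ᶠ n : ℕ in atTop,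
      ∀ u : Vec d, c * n * ‖u‖ ^ 2 ≤ u.ofLp ⬝ᵥ (R.B M Sig n ω).mulVec u.ofLp := by
  obtain ⟨c, hc, ρ, h0, h1, K, hK, h⟩ := hR.exists_lower_bound hSig
  refine ⟨c, hc, ?_⟩
  have hsum : Summable fun n : ℕ => K * ρ ^ n := (summable_geometric_of_lt_one h0.le h1).mul_left K
  have hb := ae_eventually_notMem (μ := P) (s := fun n : ℕ =>
    {ω | ¬ ∀ u : Vec d, c * n * ‖u‖ ^ 2 ≤ u.ofLp ⬝ᵥ (R.B M Sig n ω).mulVec u.ofLp}) ?_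
  · filter_upwards [hb] with ω hω
    filter_upwards [hω] with n hn
    simpa using hn
  · refine ne_top_of_le_ne_top hsum.tsum_ofReal_ne_top (ENNReal.tsum_le_tsum fun n => ?_)
    rw [← ofReal_measureReal]
    exact ENNReal.ofReal_le_ofReal (h n)

end IsThompsonSampling

end Run

end

/-! ### Selection without ties, the martingale structure, and consistency -/

section

variable {d N : ℕ}

/-- The pairs of arm data and parameter for which arm `i` maximizes the estimated reward. -/
def Params.maxSet (M : Params d) (i : Fin N) : Set ((Fin N → Vec d × Vec d × ℝ) × Vec d) :=
  {p | ∀ j, inner ℝ (M.est (p.1 j)) p.2 ≤ inner ℝ (M.est (p.1 i)) p.2}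

/-- The pairs of arm data and parameter for which the estimated rewards are distinct. -/
def Params.distinctSet (M : Params d) (N : ℕ) : Set ((Fin N → Vec d × Vec d × ℝ) × Vec d) :=
  {p | ∀ i j, inner ℝ (M.est (p.1 i)) p.2 = inner ℝ (M.est (p.1 j)) p.2 → i = j}

/-- The value of `f` at the data of the arm that maximizes the estimated reward. -/
def Params.pick (M : Params d) (f : Vec d × Vec d × ℝ → ℝ)
    (p : (Fin N → Vec d × Vec d × ℝ) × Vec d) : ℝ :=
  ∑ i, (M.maxSet i).indicator (fun p => f (p.1 i)) p

/-- The expectation of `f` at the data of the arm selected under the parameter `v`. -/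
def Params.pickMean (M : Params d) (N : ℕ) (f : Vec d × Vec d × ℝ → ℝ) (v : Vec d) : ℝ :=
  ∫ e, M.pick (N := N) f (e, v) ∂(M.envLaw N)

namespace Params

variable (M : Params d)

theorem measurable_inner_est (i : Fin N) : Measurable
    fun p : (Fin N → Vec d × Vec d × ℝ) × Vec d => (inner ℝ (M.est (p.1 i)) p.2 : ℝ) := by
  fun_prop

theorem measurableSet_maxSet (i : Fin N) : MeasurableSet (M.maxSet i) := by
  have : M.maxSet i = ⋂ j, {p : (Fin N → Vec d × Vec d × ℝ) × Vec d |
      inner ℝ (M.est (p.1 j)) p.2 ≤ inner ℝ (M.est (p.1 i)) p.2} := by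
    ext p; simp [maxSet]
  rw [this]
  exact MeasurableSet.iInter fun j =>
    measurableSet_le (M.measurable_inner_est j) (M.measurable_inner_est i)

theorem measurableSet_distinctSet : MeasurableSet (M.distinctSet N) := by
  have : M.distinctSet N = ⋂ (i : Fin N), ⋂ (j : Fin N), ⋂ (_ : i ≠ j),
      {p : (Fin N → Vec d × Vec d × ℝ) × Vec d |
        inner ℝ (M.est (p.1 i)) p.2 = inner ℝ (M.est (p.1 j)) p.2}ᶜ := by
    ext p
    simp only [distinctSet, Set.mem_ofPred_eq, Set.mem_iInter, Set.mem_compl_iff]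
    exact forall₂_congr fun i j => ⟨fun h hij he => hij (h he), fun h he => by_contra fun hij =>
      h hij he⟩
  rw [this]
  exact MeasurableSet.iInter fun i => MeasurableSet.iInter fun j => MeasurableSet.iInter fun _ =>
    (measurableSet_eq_fun (M.measurable_inner_est i) (M.measurable_inner_est j)).compl

theorem measurable_pick {f : Vec d × Vec d × ℝ → ℝ} (hf : Measurable f) :
    Measurable (M.pick (N := N) f) :=
  Finset.measurable_fun_sum _ fun i _ =>
    (hf.comp ((measurable_pi_apply i).comp measurable_fst)).indicator (M.measurableSet_maxSet i)

theorem abs_pick_le (f : Vec d × Vec d × ℝ → ℝ) (p : (Fin N → Vec d × Vec d × ℝ) × Vec d) :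
    |M.pick f p| ≤ ∑ i, |f (p.1 i)| := by
  refine (Finset.abs_sum_le_sum_abs _ _).trans (Finset.sum_le_sum fun i _ => ?_)
  by_cases h : p ∈ M.maxSet i <;> simp [h]

theorem pick_eq {p : (Fin N → Vec d × Vec d × ℝ) × Vec d} (hp : p ∈ M.distinctSet N) {a : Fin N}
    (ha : p ∈ M.maxSet a) (f : Vec d × Vec d × ℝ → ℝ) : M.pick f p = f (p.1 a) := by
  rw [pick, Finset.sum_eq_single a]
  · simp [ha]
  · intro b _ hb
    rw [Set.indicator_of_notMem]
    exact fun hb' => hb (hp b a (le_antisymm (ha b) (hb' a)))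
  · simp

/-- The estimated rewards of two arms are independent with an atomless law, so the diagonal is null.
-/
theorem ae_mem_distinctSet {v : Vec d} (hv : v ≠ 0) :
    ∀ᵐ e ∂(M.envLaw N), (e, v) ∈ M.distinctSet N := by
  have hφ : Measurable fun z => (inner ℝ (M.est z) v : ℝ) := by fun_prop
  have hnull : ∀ c : ℝ, (M.armLaw.map fun z => (inner ℝ (M.est z) v : ℝ)) {c} = 0 := by
    intro c
    rw [Measure.map_apply hφ (measurableSet_singleton c)]
    convert M.armLaw_inner_est_eq_null hv c using 2
    ext z
    simp [real_inner_comm v]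
  have hind : iIndepFun (fun (i : Fin N) e => (inner ℝ (M.est (e i)) v : ℝ)) (M.envLaw N) :=
    iIndepFun_pi (μ := fun _ : Fin N => M.armLaw) (X := fun _ z => (inner ℝ (M.est z) v : ℝ))
      fun _ => hφ.aemeasurable
  have hlaw : ∀ i : Fin N, (M.envLaw N).map (fun e => (inner ℝ (M.est (e i)) v : ℝ)) =
      M.armLaw.map fun z => (inner ℝ (M.est z) v : ℝ) := by
    intro i
    have h := (measurePreserving_eval (fun _ : Fin N => M.armLaw) i).map_eq
    conv_rhs => rw [← h]
    rw [Measure.map_map hφ (measurable_pi_apply i)]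
    rfl
  have : IsProbabilityMeasure (M.armLaw.map fun z => (inner ℝ (M.est z) v : ℝ)) :=
    Measure.isProbabilityMeasure_map hφ.aemeasurable
  have hmeas : ∀ i : Fin N, Measurable fun e : Fin N → Vec d × Vec d × ℝ =>
      (inner ℝ (M.est (e i)) v : ℝ) := fun i => hφ.comp (measurable_pi_apply i)
  simp only [distinctSet, Set.mem_ofPred_eq]
  rw [ae_all_iff]
  intro i
  rw [ae_all_iff]
  intro j
  rcases eq_or_ne i j with rfl | hij
  · exact Eventually.of_forall fun _ _ => rfl
  have h1 := (indepFun_iff_map_prod_eq_prod_map_map (hmeas i).aemeasurable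
    (hmeas j).aemeasurable).1 (hind.indepFun hij)
  rw [hlaw, hlaw] at h1
  have hdiag : MeasurableSet {p : ℝ × ℝ | p.1 = p.2} :=
    measurableSet_eq_fun measurable_fst measurable_snd
  have h2 : ((M.armLaw.map fun z => (inner ℝ (M.est z) v : ℝ)).prod
      (M.armLaw.map fun z => (inner ℝ (M.est z) v : ℝ))) {p : ℝ × ℝ | p.1 = p.2} = 0 := by
    rw [Measure.measure_prod_null hdiag]
    refine Eventually.of_forall fun x => ?_
    have hx : Prod.mk x ⁻¹' {p : ℝ × ℝ | p.1 = p.2} = {x} := by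
      ext y
      simp [eq_comm]
    simp only [hx, hnull, Pi.zero_apply]
  rw [← h1, Measure.map_apply ((hmeas i).prodMk (hmeas j)) hdiag] at h2
  filter_upwards [compl_mem_ae_iff.2 h2] with e he h
  exact absurd h he

theorem integrable_sum_abs {f : Vec d × Vec d × ℝ → ℝ} (hf : Integrable f M.armLaw) :
    Integrable (fun e : Fin N → Vec d × Vec d × ℝ => ∑ i, |f (e i)|) (M.envLaw N) :=
  integrable_finsetSum _ fun i _ =>
    ((measurePreserving_eval (fun _ : Fin N => M.armLaw) i).integrable_comp_of_integrable hf).abs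

theorem memLp_sum_abs {f : Vec d × Vec d × ℝ → ℝ} {p : ENNReal} (hf : MemLp f p M.armLaw) :
    MemLp (fun e : Fin N → Vec d × Vec d × ℝ => ∑ i, |f (e i)|) p (M.envLaw N) :=
  memLp_finsetSum _ fun i _ =>
    (hf.comp_measurePreserving (measurePreserving_eval (fun _ : Fin N => M.armLaw) i)).abs

theorem abs_pickMean_le {f : Vec d × Vec d × ℝ → ℝ} (hf : Integrable f M.armLaw) (v : Vec d) :
    |M.pickMean N f v| ≤ ∫ e, ∑ i, |f (e i)| ∂(M.envLaw N) :=
  norm_integral_le_of_norm_le (f := fun e : Fin N → Vec d × Vec d × ℝ => M.pick f (e, v))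
    (M.integrable_sum_abs hf) (Eventually.of_forall fun e => M.abs_pick_le f (e, v))

theorem measurable_pickMean {f : Vec d × Vec d × ℝ → ℝ} (hf : Measurable f) :
    Measurable (M.pickMean N f) :=
  ((M.measurable_pick hf).stronglyMeasurable.integral_prod_left' (μ := M.envLaw N)).measurable

/-- Changing the sign of all prediction errors at once preserves the joint law and the selection,
but reverses the integrand. The mean therefore equals its own negative. -/
theorem pickMean_resid_mul_est (k : Fin d) (v : Vec d) :
    M.pickMean N (fun z => M.resid z * M.est z k) v = 0 := by
  let ψ : (Fin N → Vec d × ℝ) → ℝ := fun w =>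
    ∑ i, {w : Fin N → Vec d × ℝ | ∀ j, inner ℝ (w j).1 v ≤ inner ℝ (w i).1 v}.indicator
      (fun w => (w i).2 * (w i).1 k) w
  have hψ : Measurable ψ := by
    refine Finset.measurable_fun_sum _ fun i _ => Measurable.indicator (by fun_prop) ?_
    have : {w : Fin N → Vec d × ℝ | ∀ j, inner ℝ (w j).1 v ≤ inner ℝ (w i).1 v} =
        ⋂ j, {w : Fin N → Vec d × ℝ | inner ℝ (w j).1 v ≤ inner ℝ (w i).1 v} := by
      ext w; simp
    rw [this]
    exact MeasurableSet.iInter fun j => measurableSet_le (by fun_prop) (by fun_prop)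
  have h1 : ∀ e, M.pick (N := N) (fun z => M.resid z * M.est z k) (e, v) =
      ψ fun i => (M.est (e i), M.resid (e i)) := fun e => rfl
  have h2 : ∀ e : Fin N → Vec d × Vec d × ℝ, ψ (fun i => (M.est (e i), -M.resid (e i))) =
      -ψ fun i => (M.est (e i), M.resid (e i)) := by
    intro e
    simp only [ψ]
    rw [← Finset.sum_neg_distrib]
    refine Finset.sum_congr rfl fun i _ => ?_
    simp [Set.indicator_apply]
    split_ifs <;> simp
  have m1 : Measurable fun (e : Fin N → Vec d × Vec d × ℝ) i => (M.est (e i), M.resid (e i)) := by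
    fun_prop
  have m2 : Measurable fun (e : Fin N → Vec d × Vec d × ℝ) i =>
    (M.est (e i), -M.resid (e i)) := by fun_prop
  have h3 : M.pickMean N (fun z => M.resid z * M.est z k) v =
      -M.pickMean N (fun z => M.resid z * M.est z k) v := by
    conv_rhs => rw [pickMean, ← integral_neg]
    simp only [pickMean, h1, ← h2]
    rw [← integral_map m1.aemeasurable hψ.aestronglyMeasurable,
      ← integral_map m2.aemeasurable hψ.aestronglyMeasurable, M.map_envLaw_est_neg_resid]
  linarith

theorem memLp_est (k : Fin d) {p : ENNReal} (hp : p ≠ ⊤) :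
    MemLp (fun z => M.est z k) p M.armLaw :=
  ((EuclideanSpace.proj k : Vec d →L[ℝ] ℝ).comp M.est).comp_memLp' (IsGaussian.memLp_id _ p hp)

theorem memLp_resid {p : ENNReal} (hp : p ≠ ⊤) : MemLp (fun z => M.resid z) p M.armLaw :=
  M.resid.comp_memLp' (IsGaussian.memLp_id _ p hp)

theorem measurable_resid_mul_est (k : Fin d) :
    Measurable fun z => M.resid z * M.est z k := by fun_prop

/-- Exponent `4`, not `2`, because the mean squared error estimate needs fourth moments of the
score. -/
theorem memLp_resid_mul_est (k : Fin d) : MemLp (fun z => M.resid z * M.est z k) 4 M.armLaw := by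
  have : ENNReal.HolderTriple 8 8 4 := ⟨by
    rw [← two_mul, ← ENNReal.toReal_eq_toReal_iff' (by finiteness) (by finiteness)]; norm_num⟩
  exact (M.memLp_est k (p := 8) (by simp)).mul' (M.memLp_resid (p := 8) (by simp))

theorem memLp_est_mul_est (k l : Fin d) : MemLp (fun z => M.est z k * M.est z l) 2 M.armLaw := by
  have : ENNReal.HolderTriple 4 4 2 := ⟨by
    rw [← two_mul, ← ENNReal.toReal_eq_toReal_iff' (by finiteness) (by finiteness)]; norm_num⟩
  exact (M.memLp_est l (p := 4) (by simp)).mul' (M.memLp_est k (p := 4) (by simp))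

end Params

namespace Run

variable {Ω : Type*} {R : Run Ω d N} {M : Params d} {Sig : Matrix (Fin d) (Fin d) ℝ}

/-- Summing over all arms removes the dependence on the selection rule, so moments reduce to those
of `envLaw`. -/
theorem abs_sel_le (f : Vec d × Vec d × ℝ → ℝ) (n : ℕ) (ω : Ω) :
    |f (R.sel n ω)| ≤ ∑ i, |f (R.env n ω i)| :=
  Finset.single_le_sum (f := fun i => |f (R.env n ω i)|) (fun _ _ => abs_nonneg _)
    (Finset.mem_univ (R.arm n ω))

theorem score_apply (n : ℕ) (ω : Ω) (k : Fin d) :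
    R.score M n ω k = ∑ s ∈ Finset.range n, M.resid (R.sel s ω) * M.est (R.sel s ω) k := by
  simp [score]

namespace IsThompsonSampling

variable [mΩ : MeasurableSpace Ω] {P : Measure Ω}

theorem integral_env (hR : R.IsThompsonSampling M Sig P) (n : ℕ)
    {g : (Fin N → Vec d × Vec d × ℝ) → ℝ} (hg : Measurable g) :
    ∫ ω, g (R.env n ω) ∂P = ∫ e, g e ∂(M.envLaw N) := by
  rw [← hR.map_env n, integral_map (hR.measurable_env n).aemeasurable hg.aestronglyMeasurable]

theorem memLp_sum_abs_env (hR : R.IsThompsonSampling M Sig P) {f : Vec d × Vec d × ℝ → ℝ}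
    {p : ENNReal} (hf : MemLp f p M.armLaw) (n : ℕ) :
    MemLp (fun ω => ∑ i, |f (R.env n ω i)|) p P :=
  (M.memLp_sum_abs hf).comp_measurePreserving ⟨hR.measurable_env n, hR.map_env n⟩

theorem memLp_sel (hR : R.IsThompsonSampling M Sig P) {f : Vec d × Vec d × ℝ → ℝ}
    (hfm : Measurable f) {p : ENNReal} (hf : MemLp f p M.armLaw) (n : ℕ) :
    MemLp (fun ω => f (R.sel n ω)) p P :=
  (hR.memLp_sum_abs_env hf n).mono (hfm.comp (hR.measurable_sel n)).aestronglyMeasurable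
    (Eventually.of_forall fun ω => (abs_sel_le f n ω).trans (le_abs_self _))

theorem integral_sel_pow_le (hR : R.IsThompsonSampling M Sig P) {f : Vec d × Vec d × ℝ → ℝ}
    (hfm : Measurable f) {k : ℕ} (hk : k ≠ 0) (hf : MemLp f k M.armLaw) (n : ℕ) :
    ∫ ω, |f (R.sel n ω)| ^ k ∂P ≤ ∫ e : Fin N → _, (∑ i, |f (e i)|) ^ k ∂(M.envLaw N) := by
  have hg : Measurable fun e : Fin N → Vec d × Vec d × ℝ => (∑ i, |f (e i)|) ^ k := by
    refine Measurable.pow_const (Finset.measurable_fun_sum _ fun i _ => ?_) k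
    exact measurable_abs.comp (hfm.comp (measurable_pi_apply i))
  rw [← hR.integral_env n hg]
  refine integral_mono ?_ ?_ fun ω => pow_le_pow_left₀ (abs_nonneg _) (abs_sel_le f n ω) k
  · exact (hR.memLp_sel hfm hf n).integrable_norm_pow hk
  · refine ((hR.memLp_sum_abs_env hf n).integrable_norm_pow hk).congr
      (Eventually.of_forall fun ω => ?_)
    simp only [Real.norm_eq_abs]
    rw [abs_of_nonneg (Finset.sum_nonneg fun _ _ => abs_nonneg _)]

variable [IsProbabilityMeasure P]

/-- The sample is conditionally a nondegenerate Gaussian. The value `0` must be excluded because all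
arms tie there. -/
theorem ae_draw_ne_zero (hR : R.IsThompsonSampling M Sig P) (hSig : Sig.PosDef) (hd : 0 < d)
    (n : ℕ) : ∀ᵐ ω ∂P, R.draw n ω ≠ 0 := by
  let u : Vec d := EuclideanSpace.single ⟨0, hd⟩ 1
  have hu : u ≠ 0 := by simp [u]
  have hs : MeasurableSet (R.draw n ⁻¹' {0}) := hR.measurable_draw n (measurableSet_singleton 0)
  have h1 := integral_condExp (hR.history_le n) (μ := P)
    (f := (R.draw n ⁻¹' {0}).indicator fun _ => (1 : ℝ))
  have h2 : ∀ ω, (multivariateGaussian (R.muHat M Sig n ω) (R.B M Sig n ω)⁻¹).real {0} = 0 := by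
    intro ω
    refine (measureReal_eq_zero_iff).2 (measure_mono_null ?_
      (multivariateGaussian_inner_eq_null (R.posDef_B M hSig n ω).inv hu 0))
    simp
  have h3 : ∫ ω, (P⟦R.draw n ⁻¹' {0} | R.history n⟧) ω ∂P = 0 := by
    rw [integral_congr_ae (hR.draw_law n {0} (measurableSet_singleton 0))]
    simp [h2]
  rw [h3, integral_indicator_const _ hs, smul_eq_mul, mul_one, eq_comm,
    measureReal_eq_zero_iff] at h1
  exact compl_mem_ae_iff.2 h1

theorem ae_mem_distinctSet (hR : R.IsThompsonSampling M Sig P) (hSig : Sig.PosDef) (hd : 0 < d)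
    (n : ℕ) : ∀ᵐ ω ∂P, (R.env n ω, R.draw n ω) ∈ M.distinctSet N := by
  have hind : IndepFun (R.draw n) (R.env n) P :=
    indep_of_indep_of_le_left (hR.indep_env n).symm le_sup_right
  have h1 := (indepFun_iff_map_prod_eq_prod_map_map (hR.measurable_draw n).aemeasurable
    (hR.measurable_env n).aemeasurable).1 hind
  have hs : MeasurableSet (Prod.swap ⁻¹' (M.distinctSet N)ᶜ) :=
    measurable_swap M.measurableSet_distinctSet.compl
  have : IsProbabilityMeasure (P.map (R.draw n)) :=
    Measure.isProbabilityMeasure_map (hR.measurable_draw n).aemeasurable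
  have h2 : ((P.map (R.draw n)).prod (M.envLaw N)) (Prod.swap ⁻¹' (M.distinctSet N)ᶜ) = 0 := by
    rw [Measure.measure_prod_null hs]
    have h3 : ∀ᵐ v ∂(P.map (R.draw n)), v ≠ 0 :=
      (ae_map_iff (hR.measurable_draw n).aemeasurable
        (measurableSet_singleton (0 : Vec d)).compl).2 (hR.ae_draw_ne_zero hSig hd n)
    filter_upwards [h3] with v hv
    exact compl_mem_ae_iff.1 (by
      filter_upwards [M.ae_mem_distinctSet (N := N) hv] with e he
      exact fun h => h he)
  rw [hR.map_env] at h1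
  rw [← h1, Measure.map_apply ((hR.measurable_draw n).prodMk (hR.measurable_env n)) hs] at h2
  filter_upwards [compl_mem_ae_iff.2 h2] with ω hω
  simpa using hω

/-- The tie-breaking rule is arbitrary and may depend on anything; with ties null, the selected data
are a function of the environment and the sample. -/
theorem ae_sel_eq_pick (hR : R.IsThompsonSampling M Sig P) (hSig : Sig.PosDef) (hd : 0 < d)
    (n : ℕ) (f : Vec d × Vec d × ℝ → ℝ) :
    ∀ᵐ ω ∂P, f (R.sel n ω) = M.pick f (R.env n ω, R.draw n ω) := by
  filter_upwards [hR.ae_mem_distinctSet hSig hd n, hR.arm_max n] with ω h1 h2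
  refine (M.pick_eq h1 (a := R.arm n ω) (fun j => ?_) f).symm
  have := h2 j
  rwa [xhat_eq, xhatSel_eq] at this

/-- Conditioning first on the past together with the sample, of which the environment is
independent, gives `pickMean` at the sample; the tower property then descends to the past. -/
theorem condExp_sel_sub (hR : R.IsThompsonSampling M Sig P) (hSig : Sig.PosDef) (hd : 0 < d)
    {f : Vec d × Vec d × ℝ → ℝ} (hfm : Measurable f) (hf : Integrable f M.armLaw) (n : ℕ) :
    P[fun ω => f (R.sel n ω) - M.pickMean N f (R.draw n ω) | R.history n] =ᵐ[P] 0 := by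
  have hm : R.history n ⊔ MeasurableSpace.comap (R.draw n) inferInstance ≤ mΩ :=
    sup_le (hR.history_le n) (hR.measurable_draw n).comap_le
  have hW : Measurable[R.history n ⊔ MeasurableSpace.comap (R.draw n) inferInstance] (R.draw n) :=
    (comap_measurable _).mono le_sup_right le_rfl
  have hfi : Integrable (fun ω => f (R.sel n ω)) P :=
    (hR.memLp_sel hfm (memLp_one_iff_integrable.2 hf) n).integrable le_rfl
  have hae := hR.ae_sel_eq_pick hSig hd n f
  have h1 := condExp_comp_of_indep hm (hR.measurable_env n) hW (hR.indep_env n)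
    (M.measurable_pick hfm) (hfi.congr hae)
  rw [hR.map_env n] at h1
  have hΦ : Integrable (fun ω => M.pickMean N f (R.draw n ω)) P :=
    Integrable.of_bound ((M.measurable_pickMean hfm).comp
      (hR.measurable_draw n)).aestronglyMeasurable _
      (Eventually.of_forall fun ω => M.abs_pickMean_le hf (R.draw n ω))
  have hΦm : StronglyMeasurable[R.history n ⊔ MeasurableSpace.comap (R.draw n) inferInstance]
      (fun ω => M.pickMean N f (R.draw n ω)) :=
    ((M.measurable_pickMean hfm).comp hW).stronglyMeasurable
  have h2 : P[fun ω => f (R.sel n ω) - M.pickMean N f (R.draw n ω) |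
      R.history n ⊔ MeasurableSpace.comap (R.draw n) inferInstance] =ᵐ[P] 0 := by
    have h3 := condExp_sub hfi hΦ
      (R.history n ⊔ MeasurableSpace.comap (R.draw n) inferInstance)
    have h4 := condExp_congr_ae (m := R.history n ⊔ MeasurableSpace.comap (R.draw n) inferInstance)
      hae
    rw [condExp_of_stronglyMeasurable hm hΦm hΦ] at h3
    filter_upwards [h1, h3, h4] with ω h1 h3 h4
    change (P[(fun ω => f (R.sel n ω)) - fun ω => M.pickMean N f (R.draw n ω) | _]) ω = 0
    rw [h3, Pi.sub_apply, h4, h1]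
    exact sub_self _
  refine (condExp_condExp_of_le le_sup_left hm).symm.trans ?_
  refine (condExp_congr_ae h2).trans ?_
  rw [condExp_zero]

/-- The filtration of histories. -/
def filtration (hR : R.IsThompsonSampling M Sig P) : Filtration ℕ mΩ :=
  ⟨R.history, R.history_mono, hR.history_le⟩

/-- Strong law of large numbers along the data of the selected arms. -/
theorem ae_tendsto_average_sel_sub (hR : R.IsThompsonSampling M Sig P) (hSig : Sig.PosDef)
    (hd : 0 < d) {f : Vec d × Vec d × ℝ → ℝ} (hfm : Measurable f) (hf : MemLp f 2 M.armLaw) :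
    ∀ᵐ ω ∂P, Tendsto (fun n : ℕ => (n : ℝ)⁻¹ * ∑ s ∈ Finset.range n,
      (f (R.sel s ω) - M.pickMean N f (R.draw s ω))) atTop (𝓝 0) := by
  have hfi : Integrable f M.armLaw := hf.integrable one_le_two
  set C := ∫ e : Fin N → _, ∑ i, |f (e i)| ∂(M.envLaw N)
  have hΦ : ∀ n, MemLp (fun ω => M.pickMean N f (R.draw n ω)) 2 P := fun n =>
    MemLp.of_bound ((M.measurable_pickMean hfm).comp
      (hR.measurable_draw n)).aestronglyMeasurable _
      (Eventually.of_forall fun ω => M.abs_pickMean_le hfi (R.draw n ω))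
  refine ae_tendsto_average_martingaleDifference (ℱ := hR.filtration)
    (ξ := fun n ω => f (R.sel n ω) - M.pickMean N f (R.draw n ω)) (fun n => ?_)
    (fun n => (hR.memLp_sel hfm hf n).sub (hΦ n))
    (K := 2 * (∫ e : Fin N → _, (∑ i, |f (e i)|) ^ 2 ∂(M.envLaw N)) + 2 * C ^ 2) (fun n => ?_)
    (fun n => hR.condExp_sel_sub hSig hd hfm hfi n)
  · have h1 : Measurable[R.history (n + 1)]
        (fun ω => f (R.sel n ω) - M.pickMean N f (R.draw n ω)) :=
      (hfm.comp (R.measurable_sel_history n.lt_succ_self)).sub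
        ((M.measurable_pickMean hfm).comp (R.measurable_draw_history n.lt_succ_self))
    exact h1.stronglyMeasurable
  · have h2 := hR.integral_sel_pow_le hfm two_ne_zero (by exact_mod_cast hf) n
    simp only [sq_abs] at h2
    have hi := (hR.memLp_sel hfm hf n).integrable_sq
    calc ∫ ω, (f (R.sel n ω) - M.pickMean N f (R.draw n ω)) ^ 2 ∂P
        ≤ ∫ ω, (2 * (f (R.sel n ω)) ^ 2 + 2 * C ^ 2) ∂P := by
          refine integral_mono ((hR.memLp_sel hfm hf n).sub (hΦ n)).integrable_sq
            ((hi.const_mul 2).add (integrable_const _)) fun ω => ?_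
          have h3 := M.abs_pickMean_le hfi (N := N) (R.draw n ω)
          have h4 : (M.pickMean N f (R.draw n ω)) ^ 2 ≤ C ^ 2 := by
            rw [← sq_abs]; exact pow_le_pow_left₀ (abs_nonneg _) h3 2
          simp only
          nlinarith [sq_nonneg (f (R.sel n ω) + M.pickMean N f (R.draw n ω))]
      _ ≤ _ := by
          rw [integral_add (hi.const_mul 2) (integrable_const _), integral_const_mul]
          simp only [integral_const, probReal_univ, smul_eq_mul, one_mul]
          gcongr

theorem ae_tendsto_average_score (hR : R.IsThompsonSampling M Sig P) (hSig : Sig.PosDef)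
    (hd : 0 < d) : ∀ᵐ ω ∂P, Tendsto (fun n : ℕ => (n : ℝ)⁻¹ • R.score M n ω) atTop (𝓝 0) := by
  have h1 : ∀ᵐ ω ∂P, ∀ k, Tendsto (fun n : ℕ => (n : ℝ)⁻¹ * R.score M n ω k) atTop (𝓝 0) := by
    rw [ae_all_iff]
    intro k
    have := hR.ae_tendsto_average_sel_sub hSig hd (M.measurable_resid_mul_est k)
      ((M.memLp_resid_mul_est k).mono_exponent (by norm_num))
    simpa only [M.pickMean_resid_mul_est, sub_zero, ← score_apply] using this
  filter_upwards [h1] with ω hω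
  have h2 : Tendsto (fun n : ℕ => ((n : ℝ)⁻¹ • R.score M n ω).ofLp) atTop (𝓝 0) :=
    tendsto_pi_nhds.2 fun k => by simpa using hω k
  have h3 := ((PiLp.continuous_toLp 2 fun _ : Fin d => ℝ).tendsto 0).comp h2
  simpa [Function.comp_def] using h3

/-- The posterior mean is strongly consistent. -/
theorem ae_tendsto_muHat (hR : R.IsThompsonSampling M Sig P) (hSig : Sig.PosDef) :
    ∀ᵐ ω ∂P, Tendsto (fun n : ℕ => R.muHat M Sig n ω) atTop (𝓝 M.μstar) := by
  -- For `d = 0` the sample is always `0` and the tie argument fails, but the space is a point.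
  rcases Nat.eq_zero_or_pos d with rfl | hd
  · refine Eventually.of_forall fun ω => ?_
    have : (fun n : ℕ => R.muHat M Sig n ω) = fun _ => M.μstar := Subsingleton.elim _ _
    rw [this]
    exact tendsto_const_nhds
  obtain ⟨c, hc, hlb⟩ := hR.ae_eventually_lower_bound hSig
  filter_upwards [hlb, hR.ae_tendsto_average_score hSig hd] with ω h1 h2
  set b : Vec d := WithLp.toLp 2 (Sig⁻¹.mulVec M.μstar.ofLp) with hb
  have h3 : Tendsto (fun n : ℕ => (n : ℝ)⁻¹ • b) atTop (𝓝 0) := by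
    have := (tendsto_inv_atTop_nhds_zero_nat (𝕜 := ℝ)).smul_const b
    simpa using this
  have h4 : Tendsto (fun n : ℕ => ‖(n : ℝ)⁻¹ • R.score M n ω - (n : ℝ)⁻¹ • b‖ / c) atTop (𝓝 0) := by
    have := (h2.sub h3).norm.div_const c
    simpa using this
  rw [tendsto_iff_norm_sub_tendsto_zero]
  refine squeeze_zero' (Eventually.of_forall fun _ => norm_nonneg _) ?_ h4
  filter_upwards [h1, eventually_gt_atTop 0] with n hn hn0
  have hn' : (0 : ℝ) < n := by exact_mod_cast hn0
  refine (R.norm_muHat_sub_le M hSig (by positivity) hn).trans_eq ?_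
  rw [← smul_sub, norm_smul, norm_inv, Real.norm_eq_abs, abs_of_pos hn']
  field_simp
  rw [hb]

end IsThompsonSampling

end Run

end

/-! ### Moments and the decay of the covariance -/

section

variable {d N : ℕ}

theorem measurable_det {Ω : Type*} [MeasurableSpace Ω] {A : Ω → Matrix (Fin d) (Fin d) ℝ}
    (hA : ∀ i j, Measurable fun ω => A ω i j) : Measurable fun ω => (A ω).det := by
  simp only [Matrix.det_apply']
  exact Finset.measurable_fun_sum _ fun τ _ =>
    (Finset.measurable_fun_prod _ fun i _ => hA _ _).const_mul _

theorem measurable_inv_apply {Ω : Type*} [MeasurableSpace Ω] {A : Ω → Matrix (Fin d) (Fin d) ℝ}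
    (hA : ∀ i j, Measurable fun ω => A ω i j) (i j : Fin d) :
    Measurable fun ω => (A ω)⁻¹ i j := by
  simp only [Matrix.inv_def, Matrix.smul_apply, Matrix.adjugate_apply, Ring.inverse_eq_inv',
    smul_eq_mul]
  refine (measurable_det hA).inv.mul (measurable_det fun k l => ?_)
  by_cases hk : k = j
  · subst hk
    simp only [Matrix.updateRow_self]
    exact measurable_const
  · simp only [Matrix.updateRow_ne hk]
    exact hA k l

theorem measurable_mulVec_apply {Ω : Type*} [MeasurableSpace Ω] {A : Ω → Matrix (Fin d) (Fin d) ℝ}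
    {v : Ω → Fin d → ℝ} (hA : ∀ i j, Measurable fun ω => A ω i j) (hv : Measurable v) (i : Fin d) :
    Measurable fun ω => (A ω).mulVec (v ω) i := by
  simp only [Matrix.mulVec, dotProduct]
  exact Finset.measurable_fun_sum _ fun j _ => (hA i j).mul ((measurable_pi_apply j).comp hv)

theorem pow_four_sum_le {ι : Type*} (s : Finset ι) (a : ι → ℝ) :
    (∑ i ∈ s, a i) ^ 4 ≤ (s.card : ℝ) ^ 3 * ∑ i ∈ s, a i ^ 4 := by
  have h1 := sq_sum_le_card_mul_sum_sq (s := s) (f := a)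
  have h2 := sq_sum_le_card_mul_sum_sq (s := s) (f := fun i => a i ^ 2)
  calc (∑ i ∈ s, a i) ^ 4 = ((∑ i ∈ s, a i) ^ 2) ^ 2 := by ring
    _ ≤ (s.card * ∑ i ∈ s, a i ^ 2) ^ 2 := pow_le_pow_left₀ (sq_nonneg _) h1 2
    _ = (s.card : ℝ) ^ 2 * (∑ i ∈ s, a i ^ 2) ^ 2 := by ring
    _ ≤ (s.card : ℝ) ^ 2 * (s.card * ∑ i ∈ s, (a i ^ 2) ^ 2) := by gcongr
    _ = _ := by
      have : ∀ i, (a i ^ 2) ^ 2 = a i ^ 4 := fun i => by ring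
      simp only [this]; ring

/-- A variance is at most the second moment about any point `m`, and `|ab| ≤ (a² + b²) / 2`. With `m
= μstar`, covariances are bounded by the mean squared error. -/
theorem abs_covariance_le {Ω : Type*} [MeasurableSpace Ω] {P : Measure Ω} [IsProbabilityMeasure P]
    {X : Ω → Vec d} (hX : MemLp X 2 P) (m : Vec d) (k l : Fin d) :
    |covariance (fun ω => X ω k) (fun ω => X ω l) P| ≤ ∫ ω, ‖X ω - m‖ ^ 2 ∂P := by
  have hXk : ∀ k, MemLp (fun ω => X ω k) 2 P := fun k =>
    (EuclideanSpace.proj k : Vec d →L[ℝ] ℝ).comp_memLp' hX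
  have hv : ∀ k, ∫ ω, (X ω k - ∫ ω', X ω' k ∂P) ^ 2 ∂P ≤ ∫ ω, ‖X ω - m‖ ^ 2 ∂P := by
    intro k
    have h1 : Var[fun ω => X ω k; P] = Var[fun ω => X ω k - m k; P] :=
      (variance_sub_const (hXk k).aestronglyMeasurable (m k)).symm
    have h2 := variance_le_expectation_sq (μ := P) (X := fun ω => X ω k - m k)
      ((hXk k).sub (memLp_const _)).aestronglyMeasurable
    rw [← h1, variance_eq_integral (hXk k).aestronglyMeasurable.aemeasurable] at h2
    refine h2.trans (integral_mono ((hXk k).sub (memLp_const _)).integrable_sq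
      ((hX.sub (memLp_const m)).integrable_norm_pow two_ne_zero) fun ω => ?_)
    have := PiLp.norm_apply_le (X ω - m) k
    rw [Real.norm_eq_abs] at this
    simp only [Pi.pow_apply]
    rw [← sq_abs]
    exact pow_le_pow_left₀ (abs_nonneg _) this 2
  have hc : ∀ k, MemLp (fun ω => X ω k - ∫ ω', X ω' k ∂P) 2 P := fun k =>
    (hXk k).sub (memLp_const _)
  rw [covariance]
  calc |∫ ω, (X ω k - ∫ ω', X ω' k ∂P) * (X ω l - ∫ ω', X ω' l ∂P) ∂P|
      ≤ ∫ ω, (2⁻¹ * (X ω k - ∫ ω', X ω' k ∂P) ^ 2 + 2⁻¹ * (X ω l - ∫ ω', X ω' l ∂P) ^ 2) ∂P := by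
        rw [← Real.norm_eq_abs]
        refine norm_integral_le_of_norm_le (((hc k).integrable_sq.const_mul _).add
          ((hc l).integrable_sq.const_mul _)) (Eventually.of_forall fun ω => ?_)
        rw [Real.norm_eq_abs, abs_mul, ← sq_abs (X ω k - _), ← sq_abs (X ω l - _)]
        nlinarith [sq_nonneg (|X ω k - ∫ ω', X ω' k ∂P| - |X ω l - ∫ ω', X ω' l ∂P|)]
    _ ≤ _ := by
        rw [integral_add ((hc k).integrable_sq.const_mul _) ((hc l).integrable_sq.const_mul _),
          integral_const_mul, integral_const_mul]
        linarith [hv k, hv l]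

theorem opNorm_le_sum (C : Matrix (Fin d) (Fin d) ℝ) :
    opNorm C ≤ ∑ i, ∑ j, |C i j| * opNorm (Matrix.single i j (1 : ℝ)) := by
  conv_lhs => rw [Matrix.matrix_eq_sum_single C]
  simp only [opNorm, map_sum]
  refine (norm_sum_le _ _).trans (Finset.sum_le_sum fun i _ => (norm_sum_le _ _).trans
    (Finset.sum_le_sum fun j _ => ?_))
  have : Matrix.single i j (C i j) = C i j • Matrix.single i j (1 : ℝ) := by simp
  rw [this, map_smul, norm_smul, Real.norm_eq_abs]

theorem exists_pow_mul_geometric_le {ρ : ℝ} (h0 : 0 < ρ) (h1 : ρ < 1) (k : ℕ) :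
    ∃ C, 0 ≤ C ∧ ∀ n : ℕ, ((n : ℝ) + 1) ^ k * ρ ^ n ≤ C := by
  have h := (tendsto_pow_const_mul_const_pow_of_abs_lt_one k
    (by rwa [abs_of_pos h0] : |ρ| < 1)).comp (tendsto_add_atTop_nat 1)
  obtain ⟨C, hC⟩ := h.bddAbove_range
  have hC' : ∀ n : ℕ, ((n : ℝ) + 1) ^ k * ρ ^ (n + 1) ≤ C := fun n => by
    simpa using hC (Set.mem_range_self n)
  refine ⟨C / ρ, ?_, fun n => ?_⟩
  · exact div_nonneg (le_trans (by positivity) (hC' 0)) h0.le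
  · rw [le_div_iff₀ h0, mul_assoc, ← pow_succ]
    exact hC' n

namespace Run

variable {Ω : Type*} {R : Run Ω d N} {M : Params d} {Sig : Matrix (Fin d) (Fin d) ℝ}

namespace IsThompsonSampling

variable [mΩ : MeasurableSpace Ω] {P : Measure Ω}

theorem measurable_B (hR : R.IsThompsonSampling M Sig P) (n : ℕ) (i j : Fin d) :
    Measurable fun ω => R.B M Sig n ω i j := by
  induction n with
  | zero => exact measurable_const
  | succ n ih =>
    simp only [B, Matrix.add_apply, Matrix.vecMulVec_apply, xhatSel_eq]
    have := hR.measurable_sel n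
    exact ih.add (by fun_prop)

theorem measurable_rewardSel (hR : R.IsThompsonSampling M Sig P) (n : ℕ) :
    Measurable (R.rewardSel M n) := by
  have h : R.rewardSel M n = _ := funext (R.rewardSel_eq M n)
  have := hR.measurable_sel n
  rw [h]
  fun_prop

theorem measurable_muHat (hR : R.IsThompsonSampling M Sig P) (n : ℕ) :
    Measurable (R.muHat M Sig n) := by
  induction n with
  | zero => exact measurable_const
  | succ n ih =>
    have h1 := hR.measurable_sel n
    have h2 := hR.measurable_rewardSel n
    have h3 : Measurable fun ω => (R.muHat M Sig n ω).ofLp := by fun_prop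
    have h4 := measurable_mulVec_apply (hR.measurable_B n) h3
    have h5 : Measurable fun ω => (R.B M Sig n ω).mulVec (R.muHat M Sig n ω).ofLp +
        R.rewardSel M n ω • (R.xhatSel M n ω).ofLp := by
      simp only [xhatSel_eq]
      exact (measurable_pi_lambda _ h4).add (by fun_prop)
    have h6 := measurable_mulVec_apply
      (fun i j => measurable_inv_apply (hR.measurable_B (n + 1)) i j) h5
    exact (PiLp.continuous_toLp 2 _).measurable.comp (measurable_pi_lambda _ h6)

theorem memLp_score_apply (hR : R.IsThompsonSampling M Sig P) (n : ℕ) (k : Fin d) :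
    MemLp (fun ω => R.score M n ω k) 4 P := by
  simp only [score_apply]
  exact memLp_finsetSum _ fun s _ =>
    hR.memLp_sel (M.measurable_resid_mul_est k) (M.memLp_resid_mul_est k) s

theorem memLp_score (hR : R.IsThompsonSampling M Sig P) (n : ℕ) : MemLp (R.score M n) 4 P := by
  have : R.score M n = fun ω => ∑ k, R.score M n ω k • (EuclideanSpace.single k 1 : Vec d) := by
    funext ω
    ext l
    simp [Pi.single_apply]
  rw [this]
  exact memLp_finsetSum _ fun k _ =>
    (ContinuousLinearMap.toSpanSingleton ℝ (EuclideanSpace.single k 1 : Vec d)).comp_memLp'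
      (hR.memLp_score_apply n k)

variable [IsProbabilityMeasure P]

/-- Orthogonality of martingale differences gives the linear second moment. The crude power-mean
bound `n ^ 4` suffices for the fourth, which is only used against an exponentially small
probability. -/
theorem exists_score_moment_bounds (hR : R.IsThompsonSampling M Sig P) (hSig : Sig.PosDef) :
    ∃ K : ℝ, 0 ≤ K ∧ ∀ n : ℕ, ∫ ω, ‖R.score M n ω‖ ^ 2 ∂P ≤ K * n ∧
      ∫ ω, ‖R.score M n ω‖ ^ 4 ∂P ≤ K * n ^ 4 := by
  let f : Fin d → Vec d × Vec d × ℝ → ℝ := fun k z => M.resid z * M.est z k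
  let K2 : Fin d → ℝ := fun k => ∫ e : Fin N → _, (∑ i, |f k (e i)|) ^ 2 ∂(M.envLaw N)
  let K4 : Fin d → ℝ := fun k => ∫ e : Fin N → _, (∑ i, |f k (e i)|) ^ 4 ∂(M.envLaw N)
  have hK2 : ∀ k, 0 ≤ K2 k := fun k => integral_nonneg fun e => by positivity
  have hK4 : ∀ k, 0 ≤ K4 k := fun k => integral_nonneg fun e => by positivity
  have f4 : ∀ k s, MemLp (fun ω => f k (R.sel s ω)) 4 P := fun k s =>
    hR.memLp_sel (M.measurable_resid_mul_est k) (M.memLp_resid_mul_est k) s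
  have f2 : ∀ k s, MemLp (fun ω => f k (R.sel s ω)) 2 P := fun k s =>
    (f4 k s).mono_exponent (by norm_num)
  have fi4 : ∀ k s, Integrable (fun ω => f k (R.sel s ω) ^ 4) P := fun k s => by
    have := (f4 k s).integrable_norm_pow (p := 4) (by norm_num)
    simpa [Even.pow_abs (by decide : Even 4)] using this
  have si4 : ∀ k n, Integrable (fun ω => R.score M n ω k ^ 4) P := fun k n => by
    have := (hR.memLp_score_apply n k).integrable_norm_pow (p := 4) (by norm_num)
    simpa [Even.pow_abs (by decide : Even 4)] using this
  have b2 : ∀ k n, ∫ ω, (R.score M n ω k) ^ 2 ∂P ≤ K2 k * n := by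
    intro k n
    simp only [score_apply]
    rw [integral_sq_sum_martingaleDifference (ℱ := hR.filtration)
      (ξ := fun s ω => f k (R.sel s ω))]
    · calc ∑ s ∈ Finset.range n, ∫ ω, (f k (R.sel s ω)) ^ 2 ∂P
          ≤ ∑ _s ∈ Finset.range n, K2 k := by
            refine Finset.sum_le_sum fun s _ => ?_
            have := hR.integral_sel_pow_le (M.measurable_resid_mul_est k) two_ne_zero
              (by exact_mod_cast (M.memLp_resid_mul_est k).mono_exponent (by norm_num)) s
            simpa only [sq_abs] using this
        _ = K2 k * n := by simp [mul_comm]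
    · intro s
      exact ((M.measurable_resid_mul_est k).comp
        (R.measurable_sel_history s.lt_succ_self)).stronglyMeasurable
    · exact f2 k
    · intro s
      have := hR.condExp_sel_sub hSig k.pos (M.measurable_resid_mul_est k)
        ((M.memLp_resid_mul_est k).integrable (by norm_num)) s
      simp only [M.pickMean_resid_mul_est, sub_zero] at this
      exact this
  have b4 : ∀ k n, ∫ ω, (R.score M n ω k) ^ 4 ∂P ≤ K4 k * n ^ 4 := by
    intro k n
    calc ∫ ω, (R.score M n ω k) ^ 4 ∂P
        ≤ ∫ ω, (n : ℝ) ^ 3 * ∑ s ∈ Finset.range n, (f k (R.sel s ω)) ^ 4 ∂P := by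
          refine integral_mono (si4 k n)
            ((integrable_finsetSum _ fun s _ => fi4 k s).const_mul _) fun ω => ?_
          simp only [score_apply]
          have := pow_four_sum_le (Finset.range n) fun s => f k (R.sel s ω)
          rwa [Finset.card_range] at this
      _ = (n : ℝ) ^ 3 * ∑ s ∈ Finset.range n, ∫ ω, (f k (R.sel s ω)) ^ 4 ∂P := by
          rw [integral_const_mul, integral_finsetSum _ fun s _ => fi4 k s]
      _ ≤ (n : ℝ) ^ 3 * ∑ _s ∈ Finset.range n, K4 k := by
          gcongr with s _
          have := hR.integral_sel_pow_le (M.measurable_resid_mul_est k) (k := 4) (by norm_num)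
              (by exact_mod_cast (M.memLp_resid_mul_est k)) s
          simpa only [Even.pow_abs (by decide : Even 4)] using this
      _ = K4 k * n ^ 4 := by simp; ring
  refine ⟨∑ k, K2 k + d * ∑ k, K4 k, add_nonneg (Finset.sum_nonneg fun k _ => hK2 k)
    (mul_nonneg (Nat.cast_nonneg _) (Finset.sum_nonneg fun k _ => hK4 k)), fun n => ⟨?_, ?_⟩⟩
  · simp only [EuclideanSpace.real_norm_sq_eq]
    rw [integral_finsetSum _ fun k _ =>
      ((hR.memLp_score_apply n k).mono_exponent (by norm_num)).integrable_sq]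
    calc ∑ k, ∫ ω, (R.score M n ω k) ^ 2 ∂P ≤ ∑ k, K2 k * n := Finset.sum_le_sum fun k _ => b2 k n
      _ = (∑ k, K2 k) * n := by rw [Finset.sum_mul]
      _ ≤ _ := by
        gcongr
        exact le_add_of_nonneg_right
          (mul_nonneg (Nat.cast_nonneg _) (Finset.sum_nonneg fun k _ => hK4 k))
  · have h : ∀ ω, ‖R.score M n ω‖ ^ 4 ≤ d * ∑ k, (R.score M n ω k) ^ 4 := by
      intro ω
      have h1 := sq_sum_le_card_mul_sum_sq (s := Finset.univ) (f := fun k => (R.score M n ω k) ^ 2)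
      rw [Finset.card_univ, Fintype.card_fin, ← EuclideanSpace.real_norm_sq_eq, ← pow_mul] at h1
      refine h1.trans_eq ?_
      congr 1
      exact Finset.sum_congr rfl fun k _ => by ring
    calc ∫ ω, ‖R.score M n ω‖ ^ 4 ∂P ≤ ∫ ω, d * ∑ k, (R.score M n ω k) ^ 4 ∂P :=
          integral_mono ((hR.memLp_score n).integrable_norm_pow (p := 4) (by norm_num))
            ((integrable_finsetSum _ fun k _ => si4 k n).const_mul _) h
      _ = d * ∑ k, ∫ ω, (R.score M n ω k) ^ 4 ∂P := by
          rw [integral_const_mul, integral_finsetSum _ fun k _ => si4 k n]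
      _ ≤ d * ∑ k, K4 k * n ^ 4 := by gcongr with k _; exact b4 k n
      _ = (d * ∑ k, K4 k) * n ^ 4 := by rw [← Finset.sum_mul]; ring
      _ ≤ _ := by
        gcongr
        exact le_add_of_nonneg_left (Finset.sum_nonneg fun k _ => hK2 k)

/-- The precision never falls below that of the prior, so the error is at most a constant times
`‖score - Sig⁻¹ μstar‖`. -/
theorem memLp_muHat (hR : R.IsThompsonSampling M Sig P) (hSig : Sig.PosDef) (n : ℕ) :
    MemLp (R.muHat M Sig n) 2 P := by
  obtain ⟨c, hc, h⟩ := exists_pos_le_quadForm hSig.inv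
  set b : Vec d := WithLp.toLp 2 (Sig⁻¹.mulVec M.μstar.ofLp) with hb
  have h1 : MemLp (fun ω => c⁻¹ • (R.score M n ω - b)) 2 P :=
    (((hR.memLp_score n).mono_exponent (by norm_num)).sub (memLp_const b)).const_smul c⁻¹
  have h2 : MemLp (fun ω => R.muHat M Sig n ω - M.μstar) 2 P := by
    refine h1.mono ((hR.measurable_muHat n).sub_const _).aestronglyMeasurable
      (Eventually.of_forall fun ω => ?_)
    refine (R.norm_muHat_sub_le M hSig hc (R.le_quadForm_B M h n ω)).trans_eq ?_
    rw [norm_smul, norm_inv, Real.norm_eq_abs, abs_of_pos hc, div_eq_inv_mul]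
  have h3 := h2.add (memLp_const M.μstar)
  refine h3.congr_norm (hR.measurable_muHat n).aestronglyMeasurable
    (Eventually.of_forall fun ω => ?_)
  simp

/-- The mean squared error of the posterior mean decays at rate `1 / n`. -/
theorem exists_integral_norm_muHat_sub_sq_le (hR : R.IsThompsonSampling M Sig P)
    (hSig : Sig.PosDef) : ∃ C : ℝ, ∀ n : ℕ, 0 < n →
      ∫ ω, ‖R.muHat M Sig n ω - M.μstar‖ ^ 2 ∂P ≤ C * ((n : ℝ) + 1)⁻¹ := by
  obtain ⟨c0, hc0, hq0⟩ := exists_pos_le_quadForm hSig.inv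
  obtain ⟨c, hc, ρ, hρ0, hρ1, K', hK', hbad⟩ := hR.exists_lower_bound hSig
  obtain ⟨K, hK, hmom⟩ := hR.exists_score_moment_bounds hSig
  obtain ⟨C6, hC6, hgeo⟩ := exists_pow_mul_geometric_le hρ0 hρ1 6
  set b : Vec d := WithLp.toLp 2 (Sig⁻¹.mulVec M.μstar.ofLp) with hb
  let W : ℕ → Ω → Vec d := fun n ω => R.score M n ω - b
  have hW4 : ∀ n, MemLp (W n) 4 P := fun n => (hR.memLp_score n).sub (memLp_const b)
  have hW2 : ∀ n, MemLp (W n) 2 P := fun n => (hW4 n).mono_exponent (by norm_num)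
  set L := 8 * K + 8 * ‖b‖ ^ 4 + 2 * ‖b‖ ^ 2 with hL
  have hL0 : 0 ≤ L := by positivity
  have hm2 : ∀ n : ℕ, ∫ ω, ‖W n ω‖ ^ 2 ∂P ≤ L * (n + 1) := by
    intro n
    have hi := ((hR.memLp_score n).mono_exponent (p := 2) (by norm_num)).integrable_norm_pow
      two_ne_zero
    calc ∫ ω, ‖W n ω‖ ^ 2 ∂P ≤ ∫ ω, (2 * ‖R.score M n ω‖ ^ 2 + 2 * ‖b‖ ^ 2) ∂P := by
          refine integral_mono ((hW2 n).integrable_norm_pow two_ne_zero)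
            ((hi.const_mul 2).add (integrable_const _)) fun ω => ?_
          have := norm_sub_le (R.score M n ω) b
          have h2 : ‖W n ω‖ ^ 2 ≤ (‖R.score M n ω‖ + ‖b‖) ^ 2 :=
            pow_le_pow_left₀ (norm_nonneg _) this 2
          exact h2.trans (by nlinarith [sq_nonneg (‖R.score M n ω‖ - ‖b‖)])
      _ = 2 * ∫ ω, ‖R.score M n ω‖ ^ 2 ∂P + 2 * ‖b‖ ^ 2 := by
          rw [integral_add (hi.const_mul 2) (integrable_const _), integral_const_mul]
          simp
      _ ≤ 2 * (K * n) + 2 * ‖b‖ ^ 2 := by gcongr; exact (hmom n).1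
      _ ≤ L * (n + 1) := by
          rw [hL]
          have : 0 ≤ K * n := by positivity
          have : 0 ≤ ‖b‖ ^ 4 * n := by positivity
          have : 0 ≤ ‖b‖ ^ 2 * n := by positivity
          have : 0 ≤ ‖b‖ ^ 4 := by positivity
          nlinarith
  have hm4 : ∀ n : ℕ, ∫ ω, ‖W n ω‖ ^ 4 ∂P ≤ L * (n + 1) ^ 4 := by
    intro n
    have hi := (hR.memLp_score n).integrable_norm_pow (p := 4) (by norm_num)
    calc ∫ ω, ‖W n ω‖ ^ 4 ∂P ≤ ∫ ω, (8 * ‖R.score M n ω‖ ^ 4 + 8 * ‖b‖ ^ 4) ∂P := by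
          refine integral_mono ((hW4 n).integrable_norm_pow (p := 4) (by norm_num))
            ((hi.const_mul 8).add (integrable_const _)) fun ω => ?_
          have := norm_sub_le (R.score M n ω) b
          have h2 : ‖W n ω‖ ^ 4 ≤ (‖R.score M n ω‖ + ‖b‖) ^ 4 :=
            pow_le_pow_left₀ (norm_nonneg _) this 4
          have h3 := add_pow_le (norm_nonneg (R.score M n ω)) (norm_nonneg b) 4
          refine h2.trans (h3.trans_eq (by norm_num; ring))
      _ = 8 * ∫ ω, ‖R.score M n ω‖ ^ 4 ∂P + 8 * ‖b‖ ^ 4 := by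
          rw [integral_add (hi.const_mul 8) (integrable_const _), integral_const_mul]
          simp
      _ ≤ 8 * (K * n ^ 4) + 8 * ‖b‖ ^ 4 := by gcongr; exact (hmom n).2
      _ ≤ 8 * (K * (n + 1) ^ 4) + 8 * ‖b‖ ^ 4 * (n + 1) ^ 4 := by
          refine add_le_add (by gcongr; linarith) ?_
          · exact le_mul_of_one_le_right (by positivity) (one_le_pow₀ (by
              have : (0 : ℝ) ≤ n := Nat.cast_nonneg n
              linarith))
      _ ≤ L * (n + 1) ^ 4 := by
          rw [hL]
          have : 0 ≤ 2 * ‖b‖ ^ 2 * ((n : ℝ) + 1) ^ 4 := by positivity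
          linarith
  refine ⟨4 * L / c ^ 2 + (K' * C6 + L) / c0 ^ 2, fun n hn => ?_⟩
  set bad := {ω | ¬ ∀ u : Vec d, c * n * ‖u‖ ^ 2 ≤ u.ofLp ⬝ᵥ (R.B M Sig n ω).mulVec u.ofLp}
    with hbad_def
  -- A measurable hull of the same measure avoids proving that `bad` is measurable.
  set S := toMeasurable P bad with hS
  have hSm : MeasurableSet S := measurableSet_toMeasurable P bad
  have hPS : P.real S ≤ K' * ρ ^ n := by
    rw [measureReal_def, hS, measure_toMeasurable]
    exact hbad n
  have hn1 : (1 : ℝ) ≤ n := by exact_mod_cast hn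
  -- On `S` the split `‖W‖² ≤ a + a⁻¹ ‖W‖⁴` replaces Cauchy–Schwarz. The power `5` turns the fourth
  -- moment `O((n + 1) ^ 4)` into `O(1 / (n + 1))`, while `a * P(S)` decays geometrically up to a
  -- polynomial factor.
  set a : ℝ := ((n : ℝ) + 1) ^ 5 with ha
  have ha0 : 0 < a := by positivity
  have hpt : ∀ ω, ‖R.muHat M Sig n ω - M.μstar‖ ^ 2 ≤ ((c * n) ^ 2)⁻¹ * ‖W n ω‖ ^ 2 +
      ((c0 ^ 2)⁻¹ * (S.indicator (fun _ => a) ω) + (c0 ^ 2)⁻¹ * (a⁻¹ * ‖W n ω‖ ^ 4)) := by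
    intro ω
    by_cases hω : ω ∈ S
    · rw [Set.indicator_of_mem hω]
      have h1 := R.norm_muHat_sub_le M hSig hc0 (R.le_quadForm_B M hq0 n ω)
      have h2 : ‖R.muHat M Sig n ω - M.μstar‖ ^ 2 ≤ (c0 ^ 2)⁻¹ * ‖W n ω‖ ^ 2 :=
        (pow_le_pow_left₀ (norm_nonneg _) h1 2).trans_eq (by rw [div_pow, div_eq_inv_mul])
      have h3 : ‖W n ω‖ ^ 2 ≤ a + a⁻¹ * ‖W n ω‖ ^ 4 := by
        have h4 : 0 ≤ a⁻¹ * (‖W n ω‖ ^ 2 - a) ^ 2 := by positivity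
        have h5 : a⁻¹ * (‖W n ω‖ ^ 2 - a) ^ 2 = a⁻¹ * ‖W n ω‖ ^ 4 - 2 * ‖W n ω‖ ^ 2 + a := by
          field_simp
          ring
        nlinarith [sq_nonneg ‖W n ω‖]
      have h6 : 0 ≤ ((c * n) ^ 2)⁻¹ * ‖W n ω‖ ^ 2 := by positivity
      rw [← mul_add]
      have h7 := mul_le_mul_of_nonneg_left h3 (by positivity : 0 ≤ (c0 ^ 2)⁻¹)
      linarith
    · have hg : ω ∉ bad := fun h => hω (subset_toMeasurable P bad h)
      simp only [hbad_def, Set.mem_ofPred_eq, not_not] at hg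
      have h1 := R.norm_muHat_sub_le M hSig (by positivity) hg
      have h2 : ‖R.muHat M Sig n ω - M.μstar‖ ^ 2 ≤ ((c * n) ^ 2)⁻¹ * ‖W n ω‖ ^ 2 :=
        (pow_le_pow_left₀ (norm_nonneg _) h1 2).trans_eq (by rw [div_pow, div_eq_inv_mul])
      rw [Set.indicator_of_notMem hω]
      have h3 : 0 ≤ (c0 ^ 2)⁻¹ * (a⁻¹ * ‖W n ω‖ ^ 4) := by positivity
      linarith
  have i1 : Integrable (fun ω => ((c * n) ^ 2)⁻¹ * ‖W n ω‖ ^ 2) P :=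
    ((hW2 n).integrable_norm_pow two_ne_zero).const_mul _
  have i2 : Integrable (fun ω => (c0 ^ 2)⁻¹ * S.indicator (fun _ => a) ω) P :=
    ((integrable_const a).indicator hSm).const_mul _
  have i3 : Integrable (fun ω => (c0 ^ 2)⁻¹ * (a⁻¹ * ‖W n ω‖ ^ 4)) P :=
    (((hW4 n).integrable_norm_pow (p := 4) (by norm_num)).const_mul _).const_mul _
  have hle : ∫ ω, ‖R.muHat M Sig n ω - M.μstar‖ ^ 2 ∂P ≤ ((c * n) ^ 2)⁻¹ * ∫ ω, ‖W n ω‖ ^ 2 ∂P +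
      ((c0 ^ 2)⁻¹ * (P.real S * a) + (c0 ^ 2)⁻¹ * (a⁻¹ * ∫ ω, ‖W n ω‖ ^ 4 ∂P)) := by
    refine (integral_mono (((hR.memLp_muHat hSig n).sub (memLp_const _)).integrable_norm_pow
      two_ne_zero) (i1.add (i2.add i3)) hpt).trans_eq ?_
    simp only [Pi.add_apply]
    rw [integral_add i1 (g := fun ω => (c0 ^ 2)⁻¹ * S.indicator (fun _ => a) ω +
      (c0 ^ 2)⁻¹ * (a⁻¹ * ‖W n ω‖ ^ 4)) (i2.add i3), integral_add i2 i3, integral_const_mul,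
      integral_const_mul, integral_const_mul, integral_const_mul, integral_indicator_const _ hSm,
      smul_eq_mul]
  refine hle.trans ?_
  rw [add_mul]
  have hn0 : (0 : ℝ) < (n : ℝ) + 1 := by positivity
  refine add_le_add ?_ ?_
  · calc ((c * n) ^ 2)⁻¹ * ∫ ω, ‖W n ω‖ ^ 2 ∂P ≤ ((c * n) ^ 2)⁻¹ * (L * (n + 1)) := by
          gcongr; exact hm2 n
      _ = L / c ^ 2 * (((n : ℝ) + 1) / n ^ 2) := by field_simp
      _ ≤ L / c ^ 2 * (4 * ((n : ℝ) + 1)⁻¹) := by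
          refine mul_le_mul_of_nonneg_left ?_ (by positivity)
          -- The factor `4` comes from `n + 1 ≤ 2 n`.
          rw [← div_eq_mul_inv, div_le_div_iff₀ (by positivity) hn0]
          nlinarith
      _ = _ := by ring
  · calc (c0 ^ 2)⁻¹ * (P.real S * a) + (c0 ^ 2)⁻¹ * (a⁻¹ * ∫ ω, ‖W n ω‖ ^ 4 ∂P)
        ≤ (c0 ^ 2)⁻¹ * (K' * ρ ^ n * a) + (c0 ^ 2)⁻¹ * (a⁻¹ * (L * (n + 1) ^ 4)) := by
          gcongr; exact hm4 n
      _ = (c0 ^ 2)⁻¹ * (K' * (((n : ℝ) + 1) ^ 6 * ρ ^ n) + L) * ((n : ℝ) + 1)⁻¹ := by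
          rw [ha]; field_simp
      _ ≤ (c0 ^ 2)⁻¹ * (K' * C6 + L) * ((n : ℝ) + 1)⁻¹ := by gcongr; exact hgeo n
      _ = _ := by ring

/-- The covariance of the posterior mean decays at rate `1 / n`. -/
theorem isBigO_opNorm_covMat_muHat (hR : R.IsThompsonSampling M Sig P) (hSig : Sig.PosDef) :
    (fun n : ℕ => opNorm (covMat (R.muHat M Sig n) P)) =O[atTop]
      fun n : ℕ => ((n : ℝ) + 1)⁻¹ := by
  obtain ⟨C, hC⟩ := hR.exists_integral_norm_muHat_sub_sq_le hSig
  refine Asymptotics.IsBigO.of_bound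
    (∑ i : Fin d, ∑ j : Fin d, C * opNorm (Matrix.single i j (1 : ℝ))) ?_
  filter_upwards [eventually_gt_atTop 0] with n hn
  have hnn : ∀ A : Matrix (Fin d) (Fin d) ℝ, 0 ≤ opNorm A := fun A => norm_nonneg _
  rw [Real.norm_eq_abs, abs_of_nonneg (hnn _), Real.norm_eq_abs, abs_of_nonneg (by positivity)]
  refine (opNorm_le_sum _).trans ?_
  simp only [Finset.sum_mul]
  refine Finset.sum_le_sum fun i _ => Finset.sum_le_sum fun j _ => ?_
  rw [mul_right_comm]
  refine mul_le_mul_of_nonneg_right ?_ (hnn _)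
  exact (abs_covariance_le (hR.memLp_muHat hSig n) M.μstar i j).trans (hC n hn)

end IsThompsonSampling

end Run

end

/-! ### Concentration of the samples and the limit of the precision -/

section

variable {d N : ℕ}

/-- Almost surely there are no ties at `v`, and then the maximizing arm is locally constant in the
parameter; dominated convergence does the rest. -/
theorem Params.continuousAt_pickMean (M : Params d) {f : Vec d × Vec d × ℝ → ℝ} (hfm : Measurable f)
    (hf : Integrable f M.armLaw) {v : Vec d} (hv : v ≠ 0) : ContinuousAt (M.pickMean N f) v := by
  refine continuousAt_of_dominated (F := fun v e => M.pick (N := N) f (e, v))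
    (bound := fun e => ∑ i, |f (e i)|) (Eventually.of_forall fun w =>
      ((M.measurable_pick hfm).comp measurable_prodMk_right).aestronglyMeasurable)
    (Eventually.of_forall fun w => Eventually.of_forall fun e => M.abs_pick_le f (e, w))
    (M.integrable_sum_abs hf) ?_
  filter_upwards [M.ae_mem_distinctSet (N := N) hv] with e he
  have hcont : ∀ i, ContinuousAt (fun w : Vec d => (inner ℝ (M.est (e i)) w : ℝ)) v := fun i => by
    fun_prop
  have hloc : ∀ i : Fin N, ∀ᶠ w in 𝓝 v, ((e, w) ∈ M.maxSet i ↔ (e, v) ∈ M.maxSet i) := by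
    intro i
    by_cases hi : (e, v) ∈ M.maxSet i
    · have : ∀ᶠ w in 𝓝 v, ∀ j, (inner ℝ (M.est (e j)) w : ℝ) ≤ inner ℝ (M.est (e i)) w := by
        rw [eventually_all]
        intro j
        rcases eq_or_ne j i with rfl | hj
        · exact Eventually.of_forall fun _ => le_rfl
        · have hlt := lt_of_le_of_ne (hi j) fun h => hj (he j i h)
          exact ((hcont j).eventually_lt (hcont i) hlt).mono fun _ h => h.le
      exact this.mono fun w hw => iff_of_true hw hi
    · have hi' := hi
      simp only [maxSet, Set.mem_ofPred_eq, not_forall, not_le] at hi'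
      obtain ⟨j, hj⟩ := hi'
      filter_upwards [(hcont i).eventually_lt (hcont j) hj] with w hw
      exact iff_of_false (fun h => (h j).not_gt hw) hi
  refine (continuousAt_const (y := M.pick f (e, v))).congr ?_
  filter_upwards [eventually_all.2 hloc] with w hw
  refine Finset.sum_congr rfl fun i _ => ?_
  by_cases h : (e, v) ∈ M.maxSet i
  · rw [Set.indicator_of_mem h, Set.indicator_of_mem ((hw i).2 h)]
  · rw [Set.indicator_of_notMem h, Set.indicator_of_notMem fun h' => h ((hw i).1 h')]

/-- If a sequence is close to `m` with asymptotic frequency one, then averages of bounded functions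
that are continuous at `m` converge. -/
theorem tendsto_average_of_frequency {v : ℕ → Vec d} {m : Vec d} {F : Vec d → ℝ} {C : ℝ}
    (hC : ∀ x, |F x| ≤ C) (hF : ContinuousAt F m)
    (hfreq : ∀ k : ℕ, Tendsto (fun n : ℕ => (n : ℝ)⁻¹ * ∑ s ∈ Finset.range n,
      {x : Vec d | ((k : ℝ) + 1)⁻¹ ≤ ‖x - m‖}.indicator (fun _ => (1 : ℝ)) (v s)) atTop (𝓝 0)) :
    Tendsto (fun n : ℕ => (n : ℝ)⁻¹ * ∑ s ∈ Finset.range n, F (v s)) atTop (𝓝 (F m)) := by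
  rw [Metric.tendsto_atTop']
  intro ε hε
  obtain ⟨δ, hδ, hδF⟩ := Metric.continuousAt_iff.1 hF (ε / 2) (by positivity)
  obtain ⟨k, hk⟩ := exists_nat_one_div_lt hδ
  rw [one_div] at hk
  have hC0 : 0 ≤ C := (abs_nonneg _).trans (hC m)
  have h1 := (hfreq k).const_mul (2 * C)
  rw [mul_zero] at h1
  obtain ⟨n0, hn0⟩ := eventually_atTop.1 (h1.eventually_lt_const (by positivity : 0 < ε / 2))
  refine ⟨n0, fun n hn => ?_⟩
  have hn' : (0 : ℝ) < n := by exact_mod_cast lt_of_le_of_lt (Nat.zero_le _) hn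
  -- Continuity handles points near `m`, the bound `2 * C` those in a set of vanishing frequency.
  have hpt : ∀ x, |F x - F m| ≤ ε / 2 +
      2 * C * {x : Vec d | ((k : ℝ) + 1)⁻¹ ≤ ‖x - m‖}.indicator (fun _ => (1 : ℝ)) x := by
    intro x
    by_cases hx : ((k : ℝ) + 1)⁻¹ ≤ ‖x - m‖
    · rw [Set.indicator_of_mem (by exact hx)]
      have := abs_sub (F x) (F m)
      linarith [hC x, hC m]
    · rw [Set.indicator_of_notMem (by exact hx), mul_zero, add_zero]
      have := hδF (x := x) (by rw [dist_eq_norm]; linarith)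
      rw [Real.dist_eq] at this
      exact this.le
  rw [Real.dist_eq]
  have e1 : (n : ℝ)⁻¹ * ∑ s ∈ Finset.range n, F (v s) - F m =
      (n : ℝ)⁻¹ * ∑ s ∈ Finset.range n, (F (v s) - F m) := by
    rw [Finset.sum_sub_distrib]
    simp only [Finset.sum_const, Finset.card_range, nsmul_eq_mul]
    field_simp
  rw [e1, abs_mul, abs_of_pos (inv_pos.2 hn')]
  calc (n : ℝ)⁻¹ * |∑ s ∈ Finset.range n, (F (v s) - F m)|
      ≤ (n : ℝ)⁻¹ * ∑ s ∈ Finset.range n, (ε / 2 +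
        2 * C * {x : Vec d | ((k : ℝ) + 1)⁻¹ ≤ ‖x - m‖}.indicator (fun _ => (1 : ℝ)) (v s)) := by
        gcongr
        exact (Finset.abs_sum_le_sum_abs _ _).trans (Finset.sum_le_sum fun s _ => hpt _)
    _ = ε / 2 + 2 * C * ((n : ℝ)⁻¹ * ∑ s ∈ Finset.range n,
        {x : Vec d | ((k : ℝ) + 1)⁻¹ ≤ ‖x - m‖}.indicator (fun _ => (1 : ℝ)) (v s)) := by
        rw [Finset.sum_add_distrib, ← Finset.mul_sum]
        simp only [Finset.sum_const, Finset.card_range, nsmul_eq_mul]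
        field_simp
    _ < ε / 2 + ε / 2 := by gcongr; exact hn0 n hn.le
    _ = ε := by ring

namespace Run

variable {Ω : Type*} {R : Run Ω d N} {M : Params d} {Sig : Matrix (Fin d) (Fin d) ℝ}

theorem B_apply (n : ℕ) (ω : Ω) (i j : Fin d) : R.B M Sig n ω i j = Sig⁻¹ i j +
    ∑ s ∈ Finset.range n, M.est (R.sel s ω) i * M.est (R.sel s ω) j := by
  induction n with
  | zero => simp [B]
  | succ n ih =>
    rw [B, Matrix.add_apply, ih, Finset.sum_range_succ, Matrix.vecMulVec_apply, xhatSel_eq,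
      add_assoc]

namespace IsThompsonSampling

variable [mΩ : MeasurableSpace Ω] {P : Measure Ω} [IsProbabilityMeasure P]

/-- The asymptotic frequency with which the posterior sample lies in a given set is that of its
conditional probability. -/
theorem ae_tendsto_average_draw_sub (hR : R.IsThompsonSampling M Sig P) {U : Set (Vec d)}
    (hU : MeasurableSet U) : ∀ᵐ ω ∂P, Tendsto (fun n : ℕ => (n : ℝ)⁻¹ * ∑ s ∈ Finset.range n,
      (U.indicator (fun _ => (1 : ℝ)) (R.draw s ω) -
        (P⟦R.draw s ⁻¹' U | R.history s⟧) ω)) atTop (𝓝 0) := by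
  let g : ℕ → Ω → ℝ := fun n => (R.draw n ⁻¹' U).indicator fun _ => (1 : ℝ)
  have hgm : ∀ n, Measurable[R.history (n + 1)] (g n) := fun n =>
    measurable_const.indicator (R.measurable_draw_history n.lt_succ_self hU)
  have hgb : ∀ n ω, |g n ω| ≤ 1 := by
    intro n ω
    by_cases h : ω ∈ R.draw n ⁻¹' U <;> simp [g, h]
  have hgi : ∀ n, Integrable (g n) P := fun n =>
    Integrable.of_bound ((hgm n).mono (hR.history_le _) le_rfl).aestronglyMeasurable 1
      (Eventually.of_forall (hgb n))
  have hpb : ∀ n, ∀ᵐ ω ∂P, |(P[g n | R.history n]) ω| ≤ 1 := fun n =>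
    ae_bdd_abs_condExp_of_ae_bdd_abs (Eventually.of_forall (hgb n))
  have hpm : ∀ n, StronglyMeasurable[R.history n] (P[g n | R.history n]) := fun n =>
    stronglyMeasurable_condExp
  have hξm : ∀ n, StronglyMeasurable[R.history (n + 1)] (g n - P[g n | R.history n]) := fun n =>
    (hgm n).stronglyMeasurable.sub ((hpm n).mono (R.history_mono n.le_succ))
  have hξb : ∀ n, ∀ᵐ ω ∂P, ‖(g n - P[g n | R.history n]) ω‖ ≤ 2 := by
    intro n
    filter_upwards [hpb n] with ω hω
    rw [Pi.sub_apply, Real.norm_eq_abs]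
    have := abs_sub (g n ω) ((P[g n | R.history n]) ω)
    linarith [hgb n ω]
  have hξL : ∀ n, MemLp (g n - P[g n | R.history n]) 2 P := fun n =>
    MemLp.of_bound ((hξm n).mono (hR.history_le _)).aestronglyMeasurable 2 (hξb n)
  refine ae_tendsto_average_martingaleDifference (ℱ := hR.filtration)
    (ξ := fun n => g n - P[g n | R.history n]) hξm hξL (K := 4) (fun n => ?_) (fun n => ?_)
  · calc ∫ ω, ((g n - P[g n | R.history n]) ω) ^ 2 ∂P ≤ ∫ _ω, (4 : ℝ) ∂P := by
          refine integral_mono_ae (hξL n).integrable_sq (integrable_const _) ?_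
          filter_upwards [hξb n] with ω hω
          rw [Real.norm_eq_abs] at hω
          rw [← sq_abs]
          nlinarith [abs_nonneg ((g n - P[g n | R.history n]) ω)]
      _ = 4 := by simp
  · have h1 := condExp_sub (hgi n) (integrable_condExp (m := R.history n) (μ := P) (f := g n))
      (R.history n)
    rw [condExp_of_stronglyMeasurable (hR.history_le n) (hpm n) integrable_condExp, sub_self] at h1
    exact h1

/-- Once `muHat` is within `δ / 2` of `μstar`, Chebyshev bounds the conditional probability of a
sample at distance `δ` by a multiple of the trace of `B⁻¹`, which is `O(1 / n)`. Frequencies follow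
the Cesàro means of these probabilities. -/
theorem ae_tendsto_frequency_draw (hR : R.IsThompsonSampling M Sig P) (hSig : Sig.PosDef) {δ : ℝ}
    (hδ : 0 < δ) : ∀ᵐ ω ∂P, Tendsto (fun n : ℕ => (n : ℝ)⁻¹ * ∑ s ∈ Finset.range n,
      {x : Vec d | δ ≤ ‖x - M.μstar‖}.indicator (fun _ => (1 : ℝ)) (R.draw s ω)) atTop (𝓝 0) := by
  have hU : MeasurableSet {x : Vec d | δ ≤ ‖x - M.μstar‖} :=
    measurableSet_le measurable_const (by fun_prop)
  obtain ⟨c, hc, hlb⟩ := hR.ae_eventually_lower_bound hSig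
  filter_upwards [hR.ae_tendsto_average_draw_sub hU, hlb, hR.ae_tendsto_muHat hSig,
    ae_all_iff.2 fun n => hR.draw_law n _ hU] with ω h1 h2 h3 h4
  have h5 : Tendsto (fun n => (P⟦R.draw n ⁻¹' {x : Vec d | δ ≤ ‖x - M.μstar‖} | R.history n⟧) ω)
      atTop (𝓝 0) := by
    have hlim : Tendsto (fun n : ℕ => d / c / (δ / 2) ^ 2 * (n : ℝ)⁻¹) atTop (𝓝 0) := by
      simpa using (tendsto_inv_atTop_nhds_zero_nat (𝕜 := ℝ)).const_mul (d / c / (δ / 2) ^ 2)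
    refine squeeze_zero' (Eventually.of_forall fun n => ?_) ?_ hlim
    · rw [h4 n]; exact measureReal_nonneg
    have hclose : ∀ᶠ n in atTop, ‖R.muHat M Sig n ω - M.μstar‖ < δ / 2 :=
      (tendsto_iff_norm_sub_tendsto_zero.1 h3).eventually_lt_const (by positivity)
    filter_upwards [h2, hclose, eventually_gt_atTop 0] with n hn hcl hn0
    have hn' : (0 : ℝ) < n := by exact_mod_cast hn0
    rw [h4 n]
    have hB := R.posDef_B M hSig n ω
    calc (multivariateGaussian (R.muHat M Sig n ω) (R.B M Sig n ω)⁻¹).real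
          {x : Vec d | δ ≤ ‖x - M.μstar‖}
        ≤ (multivariateGaussian (R.muHat M Sig n ω) (R.B M Sig n ω)⁻¹).real
          {x : Vec d | δ / 2 ≤ ‖x - R.muHat M Sig n ω‖} := by
          refine measureReal_mono fun x (hx : δ ≤ ‖x - M.μstar‖) => ?_
          have := norm_sub_le_norm_sub_add_norm_sub x (R.muHat M Sig n ω) M.μstar
          change δ / 2 ≤ _
          linarith
      _ ≤ (R.B M Sig n ω)⁻¹.trace / (δ / 2) ^ 2 :=
          multivariateGaussian_chebyshev _ hB.inv.posSemidef (by positivity)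
      _ ≤ d / (c * n) / (δ / 2) ^ 2 := by
          gcongr
          exact trace_inv_le_of_quadForm_lower_bound hB (by positivity) hn
      _ = _ := by field_simp
  have h6 := h1.add h5.cesaro
  rw [add_zero] at h6
  refine h6.congr fun n => ?_
  rw [← mul_add, ← Finset.sum_add_distrib]
  simp

/-- The limit of the normalized precision matrices: the second moment matrix of the context
estimate that is selected under the true parameter. -/
def _root_.POCMAB.Params.limitMatrix (M : Params d) (N : ℕ) : Matrix (Fin d) (Fin d) ℝ :=
  Matrix.of fun i j => M.pickMean N (fun z => M.est z i * M.est z j) M.μstar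

theorem ae_tendsto_B (hR : R.IsThompsonSampling M Sig P) (hSig : Sig.PosDef)
    (hμ : M.μstar ≠ 0) : ∀ᵐ ω ∂P, Tendsto (fun n : ℕ => ((n : ℝ) + 1)⁻¹ • R.B M Sig n ω) atTop
      (𝓝 (M.limitMatrix N)) := by
  have hd : 0 < d := by
    rcases Nat.eq_zero_or_pos d with rfl | h
    · exact absurd (Subsingleton.elim _ _) hμ
    · exact h
  have hfm : ∀ i j, Measurable fun z => M.est z i * M.est z j := fun i j => by fun_prop
  -- Countably many radii suffice, which keeps a single null set.
  have hfreq := ae_all_iff.2 fun k : ℕ =>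
    hR.ae_tendsto_frequency_draw hSig (δ := ((k : ℝ) + 1)⁻¹) (by positivity)
  have hslln := ae_all_iff.2 fun i => ae_all_iff.2 fun j =>
    hR.ae_tendsto_average_sel_sub hSig hd (hfm i j) (M.memLp_est_mul_est i j)
  filter_upwards [hfreq, hslln] with ω h1 h2
  refine tendsto_pi_nhds.2 fun i => tendsto_pi_nhds.2 fun j => ?_
  have hfi := (M.memLp_est_mul_est i j).integrable one_le_two
  have h3 := tendsto_average_of_frequency (M.abs_pickMean_le hfi (N := N))
    (M.continuousAt_pickMean (hfm i j) hfi hμ) h1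
  have h4 : Tendsto (fun n : ℕ => (n : ℝ)⁻¹ * ∑ s ∈ Finset.range n,
      M.est (R.sel s ω) i * M.est (R.sel s ω) j) atTop (𝓝 (M.limitMatrix N i j)) := by
    have := (h2 i j).add h3
    rw [zero_add] at this
    refine this.congr fun n => ?_
    rw [← mul_add, ← Finset.sum_add_distrib]
    simp
  have h5 : Tendsto (fun n : ℕ => ((n : ℝ) + 1)⁻¹ * Sig⁻¹ i j) atTop (𝓝 0) := by
    have := (tendsto_one_div_add_atTop_nhds_zero_nat (𝕜 := ℝ)).mul_const (Sig⁻¹ i j)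
    simpa using this
  -- The normalization is by `n + 1` although there are `n` summands, hence the factor `n / (n +
  -- 1)`.
  have h6 := h5.add ((tendsto_natCast_div_add_atTop (1 : ℝ)).mul h4)
  rw [zero_add, one_mul] at h6
  refine h6.congr' ?_
  filter_upwards [eventually_gt_atTop 0] with n hn
  have hn' : (n : ℝ) ≠ 0 := by positivity
  simp only [Matrix.smul_apply, B_apply, smul_eq_mul]
  field_simp

/-- The bound `B n ≥ c n` passes to the limit. One good `ω` is enough, the limit being
deterministic. -/
theorem posDef_limitMatrix (hR : R.IsThompsonSampling M Sig P) (hSig : Sig.PosDef)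
    (hμ : M.μstar ≠ 0) : (M.limitMatrix N).PosDef := by
  obtain ⟨c, hc, hlb⟩ := hR.ae_eventually_lower_bound hSig
  obtain ⟨ω, h1, h2⟩ := (hlb.and (hR.ae_tendsto_B hSig hμ)).exists
  refine Matrix.PosDef.of_dotProduct_mulVec_pos ?_ fun x hx => ?_
  · ext i j
    simp [Params.limitMatrix, mul_comm]
  · let u : Vec d := WithLp.toLp 2 x
    have hu : 0 < ‖u‖ := norm_pos_iff.2 (by simpa [u] using hx)
    have hcont : Continuous fun A : Matrix (Fin d) (Fin d) ℝ => x ⬝ᵥ A.mulVec x := by fun_prop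
    have h3 := (hcont.tendsto _).comp h2
    have h4 : Tendsto (fun n : ℕ => (n : ℝ) / (n + 1) * (c * ‖u‖ ^ 2)) atTop
        (𝓝 (1 * (c * ‖u‖ ^ 2))) := (tendsto_natCast_div_add_atTop (1 : ℝ)).mul_const _
    have h5 : 1 * (c * ‖u‖ ^ 2) ≤ x ⬝ᵥ (M.limitMatrix N).mulVec x := by
      refine le_of_tendsto_of_tendsto h4 h3 ?_
      filter_upwards [h1] with n hn
      have h6 := hn u
      simp only [Function.comp_apply, Matrix.smul_mulVec, dotProduct_smul, smul_eq_mul]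
      calc (n : ℝ) / (n + 1) * (c * ‖u‖ ^ 2) = ((n : ℝ) + 1)⁻¹ * (c * n * ‖u‖ ^ 2) := by
            field_simp
        _ ≤ _ := by gcongr
    have h7 : 0 < 1 * (c * ‖u‖ ^ 2) := by positivity
    simpa using h7.trans_le h5

end IsThompsonSampling

end Run

end

end POCMAB

end

theorem theorem1 {Ω : Type*} [MeasurableSpace Ω] (P : Measure Ω) [IsProbabilityMeasure P]
    {d N : ℕ} (M : POCMAB.Params d) (Sig : Matrix (Fin d) (Fin d) ℝ) (hSig : Sig.PosDef)
    (R : POCMAB.Run Ω d N) (hR : R.IsThompsonSampling M Sig P) :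
    (∀ᵐ ω ∂P, Tendsto (fun n : ℕ => R.muHat M Sig n ω) atTop (𝓝 M.μstar)) ∧
    (∀ n : ℕ, MemLp (R.muHat M Sig n) 2 P) ∧
    ((fun n : ℕ => POCMAB.opNorm (POCMAB.covMat (R.muHat M Sig n) P))
      =O[atTop] fun n : ℕ => ((n : ℝ) + 1)⁻¹) ∧
    (M.μstar ≠ 0 → ∃ L : Matrix (Fin d) (Fin d) ℝ, L.PosDef ∧
      ∀ᵐ ω ∂P, Tendsto (fun n : ℕ => ((n : ℝ) + 1)⁻¹ • R.B M Sig n ω) atTop (𝓝 L)) :=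
  ⟨hR.ae_tendsto_muHat hSig, hR.memLp_muHat hSig, hR.isBigO_opNorm_covMat_muHat hSig,
    fun hμ => ⟨M.limitMatrix N, hR.posDef_limitMatrix hSig hμ, hR.ae_tendsto_B hSig hμ⟩⟩
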